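/- \textbf{Setting.} Let $d\ge 1$, $K\ge 1$, $0=R_0<R_1<\dots<R_K=R_\infty<\infty$, and let $\ell(r)=\sum_{k=0}^{K-1}A_k r^{\beta_k}\mathbf 1(R_k\le r<R_{k+1})$ be a continuous pathloss function, with $A_k>0$, $A_kR_{k+1}^{\beta_k}=A_{k+1}R_{k+1}^{\beta_{k+1}}$ for $k\le K-2$, $\beta_0\ge 0$, $\beta_k\ge d-1$ for $k\ge 1$ and $\beta_k<\beta_{k+1}$. For $\lambda>0$ let $\Phi$ be a homogeneous Poisson point process of intensity $\lambda$ on the ball of radius $R_\infty$ around the origin of $\mathbb R^d$, whose points $x_i$ carry i.i.d. marks $m_i\ge 0$ (channel powers), not identically zero, with a law not depending on $\lambda$. Put $P_i=m_i/\ell(\|x_i\|)$, let $0<W<\infty$ be the noise power, and let $$\mathrm{SINR}(\lambda)=\max_{i\in\Phi}\frac{P_i}{\sum_{j\in\Phi\setminus\{i\}}P_j+W}$$ (with value $0$ if $\Phi$ is empty). Let $\mathcal D_y(\lambda)=\lambda\,\mathbb P(\mathrm{SINR}(\lambda)\ge y)$ be the coverage density and $\mathcal A(\lambda)=\lambda\,\mathbb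 E[\log(1+\mathrm{SINR}(\lambda))]\in[0,\infty]$ the area spectral efficiency. Let $\bar F_P(t)=\mathbb P(m/\ell(\|x\|)>t)$, where $x$ is uniform on the ball and $m$ is an independent channel power. Write $\mathcal R_\rho$ for the class of positive measurable functions $h$ on $(0,\infty)$ with $h(tx)/h(x)\to t^{\rho}$ as $x\to\infty$ for all $t>0$; $h\in\mathcal R_{-\infty}$ means that this limit is $0$ for $t>1$ and $\infty$ for $0<t<1$. \textbf{Claim.} There are constants $c_{y,\alpha}\in[0,1]$ and $c_\alpha\in(0,\infty)$, for $y>0$ and $0<\alpha<1$, which depend only on $(y,\alpha)$ and only on $\alpha$, respectively, such that for every such network and every $y>0$, as $\lambda\to\infty$: \begin{enumerate} \item if $\bar F_P\in\mathcal R_0$, then $\mathcal D_y(\lambda)/\lambda\to 1$ and $\mathcal A(\lambda)/\lambda\to\infty$; \item if $\bar F_P\in\mathcal R_{-\alpha}$ with $0<\alpha<1$, then $\mathcal D_y(\lambda)/\lambda\to c_{y,\alpha}$ and $\mathcal A(\lambda)/\lambda\to c_\alpha$; \item if $\bar F_P\notin\mathcal R_{-\alpha}$ for all $\alpha\in[0,1]$,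 then $\mathcal D_y(\lambda)/\lambda\to 0$ and $\mathcal A(\lambda)/\lambda\to 0$, provided that $\bar F_P$ falls under the tail classification used here, that is, $\bar F_P\in\mathcal R_{-\alpha}$ for some $\alpha\in[0,\infty]$, or $\bar F_P(t)=o(\bar H(t))$ as $t\to\infty$ for the tail $\bar H\in\mathcal R_{-\infty}$ of some probability distribution. \end{enumerate} -/

import Mathlib

open MeasureTheory ProbabilityTheory Filter Topology
open scoped ENNReal NNReal

noncomputable section

/-! ### Regular variation -/

/-- `h` is positive and Lebesgue measurable on `(0, ∞)`. -/
def PosMeasurable (h : ℝ → ℝ) : Prop :=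
  (∀ x, 0 < x → 0 < h x) ∧ AEMeasurable h (volume.restrict (Set.Ioi 0))

/-- Karamata regular variation at `∞` with (finite) index `α`: the class `R_α`. -/
def RegularlyVarying (h : ℝ → ℝ) (α : ℝ) : Prop :=
  PosMeasurable h ∧
    ∀ t : ℝ, 0 < t → Tendsto (fun x => h (t * x) / h x) atTop (𝓝 (t ^ α))

/-- Rapid variation at `∞`: the class `R_{-∞}`. -/
def RapidlyVarying (h : ℝ → ℝ) : Prop :=
  PosMeasurable h ∧
    (∀ t : ℝ, 1 < t → Tendsto (fun x => h (t * x) / h x) atTop (𝓝 0)) ∧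
    (∀ t : ℝ, 0 < t → t < 1 → Tendsto (fun x => h (t * x) / h x) atTop atTop)

/-- The tail `1 - F` of a distribution on the real line. -/
def tailOf (μ : Measure ℝ) (t : ℝ) : ℝ := μ.real (Set.Ioi t)

/-- The tail `h` belongs to one of the classes `R_{-α}`, `0 ≤ α < ∞`, or `R_{-∞}`, or it is
`o(H̄)` for the tail `H̄` of some probability distribution with `H̄ ∈ R_{-∞}`. -/
def ClassifiedTail (h : ℝ → ℝ) : Prop :=
  (∃ α : ℝ, 0 ≤ α ∧ RegularlyVarying h (-α)) ∨
  RapidlyVarying h ∨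
  (∃ H : Measure ℝ, IsProbabilityMeasure H ∧ RapidlyVarying (tailOf H) ∧
    h =o[atTop] tailOf H)

/-! ### The network model -/

/-- The parameters of a wireless network in `ℝ^d`, apart from the density of the nodes. Only the
values `R k` for `k ≤ K` and `β k`, `A k` for `k < K` matter. -/
structure WirelessNetwork (d : ℕ) where
  /-- the dimension is positive -/
  dim_pos : 1 ≤ d
  /-- number of slopes of the pathloss -/
  K : ℕ
  K_pos : 1 ≤ K
  /-- breakpoints `0 = R 0 < R 1 < ... < R K`; the last one is the radius of the domain -/
  R : ℕ → ℝ
  R_zero : R 0 = 0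
  R_lt : ∀ k, k < K → R k < R (k + 1)
  /-- pathloss exponents -/
  β : ℕ → ℝ
  β_zero : 0 ≤ β 0
  β_ge : ∀ k, 1 ≤ k → k < K → (d : ℝ) - 1 ≤ β k
  β_lt : ∀ k, k + 1 < K → β k < β (k + 1)
  /-- pathloss factors, which make the pathloss continuous -/
  A : ℕ → ℝ
  A_pos : ∀ k, k < K → 0 < A k
  A_cont : ∀ k, k + 1 < K → A k * R (k + 1) ^ β k = A (k + 1) * R (k + 1) ^ β (k + 1)
  /-- distribution `F_m` of the channel power: nonnegative, not identically zero -/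
  channelLaw : Measure ℝ
  channelLaw_prob : IsProbabilityMeasure channelLaw
  channelLaw_nonneg : channelLaw (Set.Iio 0) = 0
  channelLaw_ne_zero : channelLaw (Set.Ioi 0) ≠ 0
  /-- average power of the background noise -/
  W : ℝ
  W_pos : 0 < W

namespace WirelessNetwork

variable {d : ℕ} (net : WirelessNetwork d)

/-- The radius `R_∞` of the network domain. -/
def radius : ℝ := net.R net.K

/-- The multi-slope pathloss function. -/
def pathloss (r : ℝ) : ℝ :=
  ∑ k ∈ Finset.range net.K,
    (Set.Ico (net.R k) (net.R (k + 1))).indicator (fun s => net.A k * s ^ net.β k) r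

/-- The network domain: the ball of radius `R_∞` around the user, who is at the origin. -/
def domain : Set (EuclideanSpace ℝ (Fin d)) := Metric.ball 0 net.radius

/-- Law of (position, channel power) of a random node: the position is uniform on the domain and
the channel power is independent of it with law `F_m`. -/
def nodeLaw : Measure (EuclideanSpace ℝ (Fin d) × ℝ) :=
  (cond (volume : Measure (EuclideanSpace ℝ (Fin d))) net.domain).prod net.channelLaw

/-- Power received from a node with position `p.1` and channel power `p.2`. -/
def power (p : EuclideanSpace ℝ (Fin d) × ℝ) : ℝ := p.2 / net.pathloss ‖p.1‖

/-- The tail `F̄_P` of the power `P` received from a random node. -/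
def powerTail (t : ℝ) : ℝ := net.nodeLaw.real {p | t < net.power p}

lemma radius_pos : 0 < net.radius := by
  have h : ∀ n, n < net.K → 0 < net.R (n + 1) := by
    intro n
    induction n with
    | zero => intro hn; simpa [net.R_zero] using net.R_lt 0 hn
    | succ n ih => intro hn; exact (ih (by omega)).trans (net.R_lt (n + 1) hn)
  obtain ⟨n, hn⟩ : ∃ n, net.K = n + 1 := ⟨net.K - 1, by have := net.K_pos; omega⟩
  have := h n (by omega)
  simpa [radius, hn] using this

instance nodeLaw_prob : IsProbabilityMeasure net.nodeLaw := by
  have := net.channelLaw_prob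
  have : IsProbabilityMeasure
      (cond (volume : Measure (EuclideanSpace ℝ (Fin d))) net.domain) :=
    cond_isProbabilityMeasure_of_finite
      (Metric.measure_ball_pos volume 0 net.radius_pos).ne' measure_ball_lt_top.ne
  unfold nodeLaw
  infer_instance

/-- A realization of the independently marked point process: the number `ω.1` of nodes, and a
sequence whose first `ω.1` entries are the nodes with their channel powers. -/
abbrev Config (d : ℕ) : Type := ℕ × (ℕ → EuclideanSpace ℝ (Fin d) × ℝ)

/-- Law of the independently marked homogeneous Poisson point process of intensity `lam` on the
domain: a Poisson number of nodes with mean `lam * volume(domain)` and, independently of this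
number, independent nodes with uniform positions and independent marks of law `F_m`. -/
def poissonLaw (lam : ℝ) : Measure (Config d) :=
  (poissonMeasure (lam * (volume : Measure (EuclideanSpace ℝ (Fin d))).real net.domain).toNNReal).prod
    (Measure.infinitePi fun _ : ℕ => net.nodeLaw)

/-- Power `P_i` received from the `i`-th node. -/
def nodePower (ω : Config d) (i : ℕ) : ℝ := net.power (ω.2 i)

/-- Interference `I_i`: the total power received from all nodes other than the `i`-th. -/
def interference (ω : Config d) (i : ℕ) : ℝ :=
  ∑ j ∈ (Finset.range ω.1).erase i, net.nodePower ω j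

/-- Signal quality `Q_i` of the `i`-th node. -/
def quality (ω : Config d) (i : ℕ) : ℝ :=
  net.nodePower ω i / (net.interference ω i + net.W)

/-- The SINR under strongest cell association, the maximum of the `Q_i` over all nodes. It is `0`
if there is no node. -/
def sinr (ω : Config d) : ℝ := ⨆ i : Fin ω.1, net.quality ω i

/-- Coverage probability at density `lam`. -/
def coverage (y lam : ℝ) : ℝ := (net.poissonLaw lam).real {ω | y ≤ net.sinr ω}

/-- Average rate at density `lam`, possibly infinite. -/
def rate (lam : ℝ) : ℝ≥0∞ :=
  ∫⁻ ω, ENNReal.ofReal (Real.log (1 + net.sinr ω)) ∂(net.poissonLaw lam)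

/-- Coverage density at density `lam`. -/
def coverageDensity (y lam : ℝ) : ℝ := lam * net.coverage y lam

/-- Area spectral efficiency at density `lam`. -/
def areaSpectralEfficiency (lam : ℝ) : ℝ≥0∞ := ENNReal.ofReal lam * net.rate lam

end WirelessNetwork

end

/-! The network enters only through the law μ of the power P received from one node, the noise W and
the mean number Λ of nodes. The received powers form a Poisson process of intensity Λμ on the line,
and the SINR is attained at the strongest of them. Hence exp(-s/SINR) is a sum over the points x of
exp(-sW/x) times a product over the other points p of exp(-sp/x)·1{p ≤ x}, up to ties. Mecke's
formula and the generating functional turn its mean into Λ∫ exp(-sW/x) exp(-Λψ_s(x)) μ(dx), where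
ψ_s(x) = ∫ (1 - exp(-sp/x)·1{p ≤ x}) μ(dp). Since μ may have atoms, the version with p ≤ x gives an
upper bound (`lintegral_invLaplace_le`) and the one with p < x a lower bound
(`le_lintegral_invLaplace`).

Let the tail F̄ have index -α with 0 ≤ α < 1. Then ψ_s(x) ~ κ F̄(x) with κ = `limitExponent α s`
(`RegularlyVarying.tendsto_exponentLE`), and large Λ makes only large x count, so the noise
disappears. The substitution v = F̄(x) would give the limit 1/κ; for laws with atoms it is replaced
by the case s = 0 of the same bounds, applied to a process of mean kΛ. So E exp(-s/SINR) → 1/κ,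
which depends on α and s only.

If α = 0 then κ = 1 for every s, and the SINR tends to infinity in probability. If 0 < α < 1, the
limits at s = n are the limits of the moments of exp(-1/SINR) ∈ [0,1]; by Weierstrass, expectations
of continuous functions of this variable are asymptotically the same for any two networks of index α
and any two large values of Λ. To pass to the indicator of SINR ≥ y at every y, one shows that
little mass lies just left of y (`exists_powerCoverage_sub_le`). This rests on the fact that at most
one point exceeds the sum of the others plus W, whence Λ E F̄(total + W) ≤ 1. The resulting Cauchy
property gives both existence and universality of the limit. The rate is the integral of the
coverage probabilities at exp(u) - 1, and a power bound in the threshold, uniform in Λ, allows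
dominated convergence.

A classified tail whose index is outside [0,1] has a finite mean. Then P(SINR ≥ y) ≤ e·E
exp(-y/SINR), and the Mecke integrand is at most a constant times x/y uniformly in Λ and tends to 0
pointwise, so dominated convergence yields the limit 0 for the coverage and then for the rate. -/

noncomputable section

/-! ### Finite Poisson processes on the real line -/

/-- Finite configurations of (labelled) powers. -/
abbrev FinConfig : Type := Σ n : ℕ, Fin n → ℝ

lemma measurable_finConfig_iff {β : Type*} [MeasurableSpace β] {f : FinConfig → β} :
    Measurable f ↔ ∀ n, Measurable fun p : Fin n → ℝ => f ⟨n, p⟩ := by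
  constructor
  · intro h n s hs
    exact MeasurableSpace.measurableSet_iInf.1 (h hs) n
  · intro h s hs
    exact MeasurableSpace.measurableSet_iInf.2 fun n => h n hs

lemma measurable_finConfig_mk (n : ℕ) : Measurable (fun p : Fin n → ℝ => (⟨n, p⟩ : FinConfig)) :=
  measurable_finConfig_iff.1 measurable_id n

/-- The law of a Poisson number with mean `Λ` of independent powers of law `μ`. -/
def poissonProcess (μ : Measure ℝ) (Λ : ℝ≥0) : Measure FinConfig :=
  Measure.sum fun n =>
    (poissonMeasure Λ {n}) • (Measure.pi fun _ : Fin n => μ).map fun p => ⟨n, p⟩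

section PoissonProcess

lemma lintegral_poissonProcess {μ : Measure ℝ} {Λ : ℝ≥0} {H : FinConfig → ℝ≥0∞} (hH : Measurable H) :
    ∫⁻ ξ, H ξ ∂(poissonProcess μ Λ) =
      ∑' n, poissonMeasure Λ {n} * ∫⁻ p, H ⟨n, p⟩ ∂(Measure.pi fun _ : Fin n => μ) := by
  rw [poissonProcess, lintegral_sum_measure]
  refine tsum_congr fun n => ?_
  rw [lintegral_smul_measure, lintegral_map hH (measurable_finConfig_mk n), smul_eq_mul]

variable {μ : Measure ℝ} [IsProbabilityMeasure μ] {Λ : ℝ≥0}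

lemma tsum_poissonMeasure_singleton (Λ : ℝ≥0) : ∑' n, poissonMeasure Λ {n} = 1 := by
  rw [← measure_univ (μ := poissonMeasure Λ), ← lintegral_one, lintegral_countable']
  simp

instance isProbabilityMeasure_poissonProcess : IsProbabilityMeasure (poissonProcess μ Λ) := by
  constructor
  rw [← lintegral_one, lintegral_poissonProcess measurable_const]
  simp [tsum_poissonMeasure_singleton]

/-- This is the size-biasing identity behind Mecke's formula: singling out one of n + 1 points
leaves n points with their usual Poisson weight, times Λ. -/
lemma poissonMeasure_succ (Λ : ℝ≥0) (n : ℕ) :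
    poissonMeasure Λ {n + 1} * (n + 1 : ℕ) = Λ * poissonMeasure Λ {n} := by
  rw [poissonMeasure_singleton, poissonMeasure_singleton, ← ENNReal.ofReal_natCast,
    ← ENNReal.ofReal_coe_nnreal, ← ENNReal.ofReal_mul (by positivity),
    ← ENNReal.ofReal_mul (by positivity)]
  congr 1
  rw [Nat.factorial_succ]
  push_cast
  field_simp
  ring

/-- Mecke's formula: `H x ξ` is summed over the points `x` of the process, where `ξ` is the process
of the other points. -/
lemma lintegral_sum_points {G : ∀ n, Fin n → (Fin n → ℝ) → ℝ≥0∞} {H : ℝ × FinConfig → ℝ≥0∞}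
    (hH : Measurable H)
    (hG : ∀ n (i : Fin (n + 1)) (x : ℝ) (p : Fin n → ℝ),
      G (n + 1) i (i.insertNth x p) = H (x, ⟨n, p⟩)) :
    ∫⁻ ξ, ∑ i, G ξ.1 i ξ.2 ∂(poissonProcess μ Λ) =
      Λ * ∫⁻ x, ∫⁻ ξ, H (x, ξ) ∂(poissonProcess μ Λ) ∂μ := by
  have hHn : ∀ n, Measurable fun q : ℝ × (Fin n → ℝ) => H (q.1, ⟨n, q.2⟩) := fun n =>
    hH.comp (measurable_fst.prodMk ((measurable_finConfig_mk n).comp measurable_snd))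
  have hGe : ∀ n (i : Fin (n + 1)) (p : Fin (n + 1) → ℝ),
      G (n + 1) i p = H ((MeasurableEquiv.piFinSuccAbove (fun _ => ℝ) i p).1,
        ⟨n, (MeasurableEquiv.piFinSuccAbove (fun _ => ℝ) i p).2⟩) := by
    intro n i p
    rw [← hG]
    congr 1
    exact ((Fin.insertNthEquiv (fun _ => ℝ) i).apply_symm_apply p).symm
  have hGm : ∀ n (i : Fin n), Measurable (G n i) := by
    intro n i
    cases n with
    | zero => exact i.elim0
    | succ n =>
      rw [show G (n + 1) i = _ from funext (hGe n i)]
      exact (hHn n).comp (MeasurableEquiv.measurable _)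
  have hint : ∀ n (i : Fin (n + 1)), ∫⁻ p, G (n + 1) i p ∂(Measure.pi fun _ => μ) =
      ∫⁻ p, ∫⁻ x, H (x, ⟨n, p⟩) ∂μ ∂(Measure.pi fun _ : Fin n => μ) := by
    intro n i
    simp_rw [hGe n i]
    rw [(measurePreserving_piFinSuccAbove (fun _ => μ) i).lintegral_comp (hHn n),
      lintegral_prod_symm' _ (hHn n)]
  have hm : Measurable fun ξ : FinConfig => ∑ i, G ξ.1 i ξ.2 :=
    measurable_finConfig_iff.2 fun n => Finset.measurable_sum Finset.univ fun i _ => hGm n i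
  -- The empty configuration contributes nothing. The remaining sum is indexed by the number n of
  -- other points, and all n + 1 choices of the distinguished point have the same integral.
  rw [lintegral_poissonProcess hm, tsum_eq_zero_add' ENNReal.summable]
  have hswap : ∫⁻ x, ∫⁻ ξ, H (x, ξ) ∂(poissonProcess μ Λ) ∂μ =
      ∫⁻ ξ, ∫⁻ x, H (x, ξ) ∂μ ∂(poissonProcess μ Λ) :=
    lintegral_lintegral_swap hH.aemeasurable
  rw [hswap, lintegral_poissonProcess hH.lintegral_prod_left', ← ENNReal.tsum_mul_left]
  simp only [Finset.univ_eq_empty, Finset.sum_empty, lintegral_zero, mul_zero, zero_add]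
  refine tsum_congr fun n => ?_
  have hsum : ∫⁻ p, ∑ i, G (n + 1) i p ∂(Measure.pi fun _ : Fin (n + 1) => μ) =
      ∑ i, ∫⁻ p, G (n + 1) i p ∂(Measure.pi fun _ : Fin (n + 1) => μ) :=
    lintegral_finsetSum _ fun i _ => hGm (n + 1) i
  rw [hsum, Finset.sum_congr rfl fun i _ => hint n i,
    Finset.sum_const, Finset.card_univ, Fintype.card_fin, nsmul_eq_mul, ← mul_assoc,
    poissonMeasure_succ, mul_assoc]

/-- The probability generating functional. -/
lemma lintegral_prod_poissonProcess {g : ℝ → ℝ≥0∞} (hg : Measurable g) {a : ℝ} (ha : 0 ≤ a)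
    (hga : ∫⁻ x, g x ∂μ = ENNReal.ofReal a) :
    ∫⁻ ξ, ∏ i, g (ξ.2 i) ∂(poissonProcess μ Λ) = ENNReal.ofReal (Real.exp (-(Λ * (1 - a)))) := by
  have hm : Measurable fun ξ : FinConfig => ∏ i, g (ξ.2 i) :=
    measurable_finConfig_iff.2 fun n =>
      Finset.measurable_prod Finset.univ fun i _ => hg.comp (measurable_pi_apply i)
  rw [lintegral_poissonProcess hm]
  have h1 : ∀ n, poissonMeasure Λ {n} *
      ∫⁻ p, ∏ i, g (p i) ∂(Measure.pi fun _ : Fin n => μ) =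
      ENNReal.ofReal (Real.exp (-Λ) * ((Λ * a) ^ n / n.factorial)) := by
    intro n
    have hind := iIndepFun_pi (μ := fun _ : Fin n => μ) (X := fun _ => g)
      fun _ => hg.aemeasurable
    have hev : ∀ i : Fin n, ∫⁻ p, g (p i) ∂(Measure.pi fun _ : Fin n => μ) = ENNReal.ofReal a := by
      intro i
      rw [← hga, (measurePreserving_eval (fun _ : Fin n => μ) i).lintegral_comp hg]
    rw [lintegral_prod_eq_prod_lintegral_of_indepFun _ _ hind
      fun i => hg.comp (measurable_pi_apply i), Finset.prod_congr rfl fun i _ => hev i, Finset.prod_const, Finset.card_univ,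
      Fintype.card_fin, poissonMeasure_singleton, ← ENNReal.ofReal_pow ha,
      ← ENNReal.ofReal_mul (by positivity)]
    congr 1
    rw [mul_pow]
    ring
  have hs := (NormedSpace.expSeries_div_hasSum_exp (Λ * a : ℝ)).mul_left (Real.exp (-Λ))
  rw [tsum_congr h1, ← ENNReal.ofReal_tsum_of_nonneg (fun n => by positivity) hs.summable,
    hs.tsum_eq, ← Real.exp_eq_exp_ℝ, ← Real.exp_add]
  congr 2
  ring

end PoissonProcess

lemma measurable_prod_finConfig {β : Type*} [MeasurableSpace β] {f : ℝ × FinConfig → β}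
    (hf : ∀ n, Measurable fun q : ℝ × (Fin n → ℝ) => f (q.1, ⟨n, q.2⟩)) : Measurable f := by
  -- Truncating or padding with zeros to length n is measurable on all configurations and is the
  -- identity on those with n points, so measurability can be checked on each slice.
  let r : ∀ n, FinConfig → Fin n → ℝ := fun n ξ i =>
    if h : (i : ℕ) < ξ.1 then ξ.2 ⟨i, h⟩ else 0
  have hr : ∀ n, Measurable (r n) := by
    intro n
    refine measurable_finConfig_iff.2 fun m => measurable_pi_iff.2 fun i => ?_
    by_cases h : (i : ℕ) < m
    · simpa [r, h] using measurable_pi_apply (⟨i, h⟩ : Fin m)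
    · simp [r, h]
  have hn : Measurable fun ξ : FinConfig => ξ.1 :=
    measurable_finConfig_iff.2 fun n => measurable_const
  intro s hs
  have : f ⁻¹' s = ⋃ n, {q : ℝ × FinConfig | q.2.1 = n} ∩
      (fun q : ℝ × FinConfig => (q.1, r n q.2)) ⁻¹'
        ((fun q : ℝ × (Fin n → ℝ) => f (q.1, ⟨n, q.2⟩)) ⁻¹' s) := by
    ext ⟨x, n, p⟩
    have : r n ⟨n, p⟩ = p := by
      ext i
      simp [r]
    constructor
    · intro h
      exact Set.mem_iUnion.2 ⟨n, rfl, by simpa [this] using h⟩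
    · intro h
      obtain ⟨m, hm, h⟩ := Set.mem_iUnion.1 h
      obtain rfl : n = m := hm
      simpa [this] using h
  rw [this]
  refine MeasurableSet.iUnion fun n => MeasurableSet.inter ?_ ?_
  · exact (hn.comp measurable_snd) (measurableSet_singleton n)
  · exact (measurable_fst.prodMk ((hr n).comp measurable_snd)) (hf n hs)

/-! ### Signal quality of a finite configuration of powers. -/

namespace FinConfig

/-- The total power. -/
def total (ξ : FinConfig) : ℝ := ∑ i, ξ.2 i

/-- The total power of all points other than the `i`-th. -/
def rest (ξ : FinConfig) (i : Fin ξ.1) : ℝ := ∑ j ∈ Finset.univ.erase i, ξ.2 j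

/-- The maximal signal quality at noise power `W`. -/
def sinr (W : ℝ) (ξ : FinConfig) : ℝ := ⨆ i, ξ.2 i / (ξ.rest i + W)

lemma measurable_total : Measurable total :=
  measurable_finConfig_iff.2 fun n => by
    unfold total
    exact Finset.measurable_sum Finset.univ fun i _ => measurable_pi_apply i

lemma measurable_sinr (W : ℝ) : Measurable (sinr W) :=
  measurable_finConfig_iff.2 fun n => by
    unfold sinr rest
    refine Measurable.iSup fun i : Fin n => (measurable_pi_apply i).div (Measurable.add_const ?_ W)
    show Measurable fun p : Fin n → ℝ => ∑ j ∈ Finset.univ.erase i, p j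
    fun_prop

lemma add_rest (ξ : FinConfig) (i : Fin ξ.1) : ξ.2 i + ξ.rest i = ξ.total :=
  Finset.add_sum_erase _ _ (Finset.mem_univ i)

lemma univ_erase_eq_map {n : ℕ} (i : Fin (n + 1)) :
    Finset.univ.erase i = Finset.univ.map i.succAboveEmb := by
  ext j
  simp [Fin.exists_succAbove_eq_iff]

end FinConfig

section Mecke

variable {μ : Measure ℝ} [IsProbabilityMeasure μ] {Λ : ℝ≥0}

/-- Mecke's formula for functions of a point and the sum of the other points. -/
lemma lintegral_sum_rest {F : ℝ × ℝ → ℝ≥0∞} (hF : Measurable F) :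
    ∫⁻ ξ : FinConfig, ∑ i, F (ξ.2 i, ξ.rest i) ∂(poissonProcess μ Λ) =
      Λ * ∫⁻ ξ : FinConfig, ∫⁻ x, F (x, ξ.total) ∂μ ∂(poissonProcess μ Λ) := by
  have hH : Measurable fun q : ℝ × FinConfig => F (q.1, q.2.total) :=
    hF.comp (measurable_fst.prodMk (FinConfig.measurable_total.comp measurable_snd))
  rw [← lintegral_lintegral_swap (f := fun x ξ => F (x, FinConfig.total ξ)) hH.aemeasurable]
  refine lintegral_sum_points (G := fun n i p => F (p i, FinConfig.rest ⟨n, p⟩ i)) hH ?_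
  intro n i x p
  simp [FinConfig.rest, FinConfig.total, FinConfig.univ_erase_eq_map]

/-- Mecke's formula for functions of a point multiplied over the other points. -/
lemma lintegral_sum_prod {h : ℝ → ℝ≥0∞} {g : ℝ → ℝ → ℝ} (hh : Measurable h)
    (hg : Measurable fun q : ℝ × ℝ => g q.1 q.2) (hg0 : ∀ x p, 0 ≤ g x p)
    (hg1 : ∀ x, ∀ᵐ p ∂μ, g x p ≤ 1) :
    ∫⁻ ξ : FinConfig, ∑ i, h (ξ.2 i) * ∏ j ∈ Finset.univ.erase i,
        ENNReal.ofReal (g (ξ.2 i) (ξ.2 j)) ∂(poissonProcess μ Λ) =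
      Λ * ∫⁻ x, h x * ENNReal.ofReal (Real.exp (-(Λ * ∫ p, (1 - g x p) ∂μ))) ∂μ := by
  have hH : Measurable fun q : ℝ × FinConfig =>
      h q.1 * ∏ j, ENNReal.ofReal (g q.1 (q.2.2 j)) := by
    refine measurable_prod_finConfig fun n => (hh.comp measurable_fst).mul ?_
    show Measurable fun q : ℝ × (Fin n → ℝ) => ∏ j, ENNReal.ofReal (g q.1 (q.2 j))
    refine Finset.measurable_fun_prod _ fun j _ => ENNReal.measurable_ofReal.comp ?_
    exact hg.comp (measurable_fst.prodMk ((measurable_pi_apply j).comp measurable_snd))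
  rw [lintegral_sum_points (G := fun n i p => h (p i) * ∏ j ∈ Finset.univ.erase i,
    ENNReal.ofReal (g (p i) (p j))) hH ?_]
  · congr 1
    refine lintegral_congr fun x => ?_
    have hgx : Measurable (g x) := hg.comp (measurable_const.prodMk measurable_id)
    have hint : Integrable (g x) μ := by
      refine Integrable.of_bound hgx.aestronglyMeasurable 1 ?_
      filter_upwards [hg1 x] with p hp
      rwa [Real.norm_of_nonneg (hg0 x p)]
    have hm : Measurable fun ξ : FinConfig => ∏ j, ENNReal.ofReal (g x (ξ.2 j)) := by
      refine measurable_finConfig_iff.2 fun n => ?_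
      show Measurable fun p : Fin n → ℝ => ∏ j, ENNReal.ofReal (g x (p j))
      fun_prop
    change ∫⁻ ξ : FinConfig, h x * ∏ j, ENNReal.ofReal (g x (ξ.2 j)) ∂_ = _
    rw [lintegral_const_mul _ hm, lintegral_prod_poissonProcess (g := fun p =>
      ENNReal.ofReal (g x p)) (ENNReal.measurable_ofReal.comp hgx)
      (integral_nonneg (hg0 x)) (ofReal_integral_eq_lintegral_ofReal hint
        (ae_of_all _ (hg0 x))).symm, integral_sub (integrable_const 1) hint]
    simp
  · intro n i x p
    simp [FinConfig.univ_erase_eq_map]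

/-- By Mecke's formula the expected number of negative points is Λ times the mass of the negative
half-line. -/
lemma ae_nonneg_poissonProcess (hμ : μ (Set.Iio 0) = 0) :
    ∀ᵐ ξ : FinConfig ∂(poissonProcess μ Λ), ∀ i, 0 ≤ ξ.2 i := by
  have hF : Measurable fun q : ℝ × ℝ => (Set.Iio (0 : ℝ)).indicator (fun _ => (1 : ℝ≥0∞)) q.1 :=
    (measurable_const.indicator measurableSet_Iio).comp measurable_fst
  have h := lintegral_sum_rest (μ := μ) (Λ := Λ) hF
  have h0 : ∫⁻ x, (Set.Iio (0 : ℝ)).indicator (fun _ => (1 : ℝ≥0∞)) x ∂μ = 0 := by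
    rw [lintegral_indicator_const measurableSet_Iio, hμ, mul_zero]
  simp only [h0, lintegral_zero, mul_zero] at h
  have hm : Measurable fun ξ : FinConfig =>
      ∑ i, (Set.Iio (0 : ℝ)).indicator (fun _ => (1 : ℝ≥0∞)) (ξ.2 i) :=
    measurable_finConfig_iff.2 fun n => Finset.measurable_sum Finset.univ fun i _ =>
      (measurable_const.indicator measurableSet_Iio).comp (measurable_pi_apply i)
  filter_upwards [(lintegral_eq_zero_iff hm).1 h] with ξ hξ i
  by_contra hi
  have := (Finset.sum_eq_zero_iff.1 hξ) i (Finset.mem_univ i)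
  rw [Set.indicator_of_mem (Set.mem_Iio.2 (not_le.1 hi))] at this
  exact one_ne_zero this

end Mecke

/-! ### The strongest point and pathwise bounds for functions of the SINR. -/

namespace FinConfig

variable {W : ℝ} {ξ : FinConfig}

lemma rest_nonneg (hξ : ∀ i, 0 ≤ ξ.2 i) (i : Fin ξ.1) : 0 ≤ ξ.rest i :=
  Finset.sum_nonneg fun j _ => hξ j

lemma total_nonneg (hξ : ∀ i, 0 ≤ ξ.2 i) : 0 ≤ ξ.total :=
  Finset.sum_nonneg fun j _ => hξ j

lemma le_rest (hξ : ∀ i, 0 ≤ ξ.2 i) {i j : Fin ξ.1} (hij : i ≠ j) : ξ.2 i ≤ ξ.rest j :=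
  Finset.single_le_sum (fun k _ => hξ k) (Finset.mem_erase.2 ⟨hij, Finset.mem_univ i⟩)

lemma quality_le_sinr (i : Fin ξ.1) : ξ.2 i / (ξ.rest i + W) ≤ ξ.sinr W :=
  le_ciSup (f := fun i => ξ.2 i / (ξ.rest i + W)) (Set.finite_range _).bddAbove i

lemma sinr_nonneg (hW : 0 < W) (hξ : ∀ i, 0 ≤ ξ.2 i) : 0 ≤ ξ.sinr W :=
  Real.iSup_nonneg fun i => div_nonneg (hξ i) (add_nonneg (rest_nonneg hξ i) hW.le)

lemma exists_eq_sinr (h : 0 < ξ.sinr W) : ∃ i, ξ.sinr W = ξ.2 i / (ξ.rest i + W) := by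
  cases isEmpty_or_nonempty (Fin ξ.1) with
  | inl _ => simp [sinr, Real.iSup_of_isEmpty] at h
  | inr _ =>
    obtain ⟨i, hi⟩ := exists_eq_ciSup_of_finite (f := fun i => ξ.2 i / (ξ.rest i + W))
    exact ⟨i, hi.symm⟩

/-- The best signal is the strongest one. -/
lemma exists_strongest (hW : 0 < W) (hξ : ∀ i, 0 ≤ ξ.2 i) (h : 0 < ξ.sinr W) :
    ∃ i, 0 < ξ.2 i ∧ (∀ j, ξ.2 j ≤ ξ.2 i) ∧ ξ.sinr W = ξ.2 i / (ξ.rest i + W) := by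
  obtain ⟨i, hi⟩ := exists_eq_sinr h
  have hD : ∀ j, 0 < ξ.rest j + W := fun j => by linarith [rest_nonneg hξ j]
  refine ⟨i, ?_, fun j => ?_, hi⟩
  · rw [hi] at h
    exact (div_pos_iff_of_pos_right (hD i)).1 h
  · have hj : ξ.2 j / (ξ.rest j + W) ≤ ξ.2 i / (ξ.rest i + W) := hi ▸ quality_le_sinr j
    -- With T the total power, both denominators are T + W minus the own power; after
    -- cross-multiplication the product of the two powers cancels and p_j (T + W) ≤ p_i (T + W)
    -- remains.
    rw [div_le_div_iff₀ (hD j) (hD i)] at hj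
    have h1 := add_rest ξ i
    have h2 := add_rest ξ j
    have h3 : 0 < ξ.total + W := by linarith [total_nonneg hξ]
    refine le_of_mul_le_mul_right ?_ h3
    have e1 : ξ.rest i = ξ.total - ξ.2 i := by linarith
    have e2 : ξ.rest j = ξ.total - ξ.2 j := by linarith
    rw [e1, e2] at hj
    nlinarith

end FinConfig

/-- The Laplace kernel `exp (-s / q)` of the inverse signal quality, extended by `0`. -/
def invLaplace (s q : ℝ) : ℝ := if 0 < q then Real.exp (-(s / q)) else 0

lemma invLaplace_nonneg (s q : ℝ) : 0 ≤ invLaplace s q := by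
  unfold invLaplace; split_ifs <;> positivity

lemma invLaplace_le_one {s : ℝ} (hs : 0 ≤ s) (q : ℝ) : invLaplace s q ≤ 1 := by
  unfold invLaplace
  split_ifs with h
  · exact Real.exp_le_one_iff.2 (neg_nonpos.2 (div_nonneg hs h.le))
  · exact zero_le_one

lemma measurable_invLaplace (s : ℝ) : Measurable (invLaplace s) :=
  Measurable.ite measurableSet_Ioi (by fun_prop) measurable_const

lemma invLaplace_mono {s : ℝ} (hs : 0 ≤ s) : Monotone (invLaplace s) := by
  intro a b hab
  unfold invLaplace
  split_ifs with h1 h2 h2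
  · exact Real.exp_le_exp.2 (neg_le_neg (div_le_div_of_nonneg_left hs h1 hab))
  · exact absurd (h1.trans_le hab) h2
  · positivity
  · exact le_rfl

/-- Moments of exp(-1/SINR) are Laplace transforms of 1/SINR at integers. The case n = 0 is excluded
because the kernel is 0 for q ≤ 0. -/
lemma invLaplace_nat_mul (n : ℕ) (hn : n ≠ 0) (q : ℝ) :
    invLaplace n q = invLaplace 1 q ^ n := by
  unfold invLaplace
  split_ifs with h
  · rw [← Real.exp_nat_mul]
    congr 1
    ring
  · simp [hn]

/-- The factor by which a power `p` damps a stronger or equal signal `x`. -/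
def dampLE (s x p : ℝ) : ℝ := if 0 < x ∧ p ≤ x then Real.exp (-(s * p / x)) else 0

/-- The factor by which a power `p` damps a strictly stronger signal `x`. -/
def dampLT (s x p : ℝ) : ℝ := if 0 < x ∧ p < x then Real.exp (-(s * p / x)) else 0

lemma dampLE_nonneg (s x p : ℝ) : 0 ≤ dampLE s x p := by
  unfold dampLE; split_ifs <;> positivity

lemma dampLT_nonneg (s x p : ℝ) : 0 ≤ dampLT s x p := by
  unfold dampLT; split_ifs <;> positivity

lemma dampLE_le_one {s x p : ℝ} (hs : 0 ≤ s) (hp : 0 ≤ p) : dampLE s x p ≤ 1 := by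
  unfold dampLE
  split_ifs with h
  · exact Real.exp_le_one_iff.2 (neg_nonpos.2 (div_nonneg (mul_nonneg hs hp) h.1.le))
  · exact zero_le_one

lemma dampLT_le_dampLE (s x p : ℝ) : dampLT s x p ≤ dampLE s x p := by
  unfold dampLE dampLT
  split_ifs with h1 h2 h2
  · exact le_rfl
  · exact absurd ⟨h1.1, h1.2.le⟩ h2
  · positivity
  · exact le_rfl

lemma measurable_dampLE (s : ℝ) : Measurable fun q : ℝ × ℝ => dampLE s q.1 q.2 :=
  Measurable.ite ((measurableSet_lt measurable_const measurable_fst).inter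
    (measurableSet_le measurable_snd measurable_fst)) (by fun_prop) measurable_const

lemma measurable_dampLT (s : ℝ) : Measurable fun q : ℝ × ℝ => dampLT s q.1 q.2 :=
  Measurable.ite ((measurableSet_lt measurable_const measurable_fst).inter
    (measurableSet_lt measurable_snd measurable_fst)) (by fun_prop) measurable_const

/-- The Laplace exponent of the relative interference by weaker or equal powers. -/
def exponentLE (μ : Measure ℝ) (s x : ℝ) : ℝ := ∫ p, (1 - dampLE s x p) ∂μ

/-- The Laplace exponent of the relative interference by strictly weaker powers. -/
def exponentLT (μ : Measure ℝ) (s x : ℝ) : ℝ := ∫ p, (1 - dampLT s x p) ∂μ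

namespace FinConfig

variable {W : ℝ} {ξ : FinConfig}

lemma invLaplace_quality (hW : 0 < W) (hξ : ∀ i, 0 ≤ ξ.2 i) (s : ℝ) {i : Fin ξ.1}
    (hi : 0 < ξ.2 i) :
    invLaplace s (ξ.2 i / (ξ.rest i + W)) = Real.exp (-(s * W / ξ.2 i)) *
      ∏ j ∈ Finset.univ.erase i, Real.exp (-(s * ξ.2 j / ξ.2 i)) := by
  have hD : 0 < ξ.rest i + W := by linarith [rest_nonneg hξ i]
  rw [invLaplace, if_pos (div_pos hi hD), ← Real.exp_sum, ← Real.exp_add, Finset.sum_neg_distrib,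
    ← Finset.sum_div, ← Finset.mul_sum]
  congr 1
  change _ = -(s * W / ξ.2 i) + -(s * ξ.rest i / ξ.2 i)
  field_simp
  ring

/-- The term of a strongest point equals the left side, since all its indicators p ≤ x hold. Tied
maxima can contribute further terms, hence only an inequality. -/
lemma invLaplace_sinr_le_sum (hW : 0 < W) (hξ : ∀ i, 0 ≤ ξ.2 i) (s : ℝ) :
    ENNReal.ofReal (invLaplace s (ξ.sinr W)) ≤
      ∑ i, ENNReal.ofReal (invLaplace (s * W) (ξ.2 i)) *
        ∏ j ∈ Finset.univ.erase i, ENNReal.ofReal (dampLE s (ξ.2 i) (ξ.2 j)) := by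
  by_cases h : 0 < ξ.sinr W
  · obtain ⟨i, hi, hmax, hQ⟩ := exists_strongest hW hξ h
    refine le_trans (le_of_eq ?_) (Finset.single_le_sum (fun _ _ => zero_le) (Finset.mem_univ i))
    rw [hQ, invLaplace_quality hW hξ s hi, invLaplace, if_pos hi,
      ENNReal.ofReal_mul (Real.exp_nonneg _), ENNReal.ofReal_prod_of_nonneg
        fun _ _ => Real.exp_nonneg _]
    congr 1
    refine Finset.prod_congr rfl fun j _ => ?_
    rw [dampLE, if_pos ⟨hi, hmax j⟩]
  · simp [invLaplace, h]

/-- A term is nonzero only for a positive point that strictly dominates all others. There is at most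
one such point, and its quality is at most the SINR. -/
lemma sum_le_invLaplace_sinr (hW : 0 < W) (hξ : ∀ i, 0 ≤ ξ.2 i) {s : ℝ} (hs : 0 ≤ s) :
    ∑ i, ENNReal.ofReal (invLaplace (s * W) (ξ.2 i)) *
        ∏ j ∈ Finset.univ.erase i, ENNReal.ofReal (dampLT s (ξ.2 i) (ξ.2 j)) ≤
      ENNReal.ofReal (invLaplace s (ξ.sinr W)) := by
  set f : Fin ξ.1 → ℝ≥0∞ := fun i => ENNReal.ofReal (invLaplace (s * W) (ξ.2 i)) *
        ∏ j ∈ Finset.univ.erase i, ENNReal.ofReal (dampLT s (ξ.2 i) (ξ.2 j)) with hf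
  have hpos : ∀ i, f i ≠ 0 → 0 < ξ.2 i ∧ ∀ j, j ≠ i → ξ.2 j < ξ.2 i := by
    intro i hi
    rw [hf] at hi
    obtain ⟨h1, h2⟩ := mul_ne_zero_iff.1 hi
    refine ⟨?_, fun j hj => ?_⟩
    · by_contra hc
      simp [invLaplace, hc] at h1
    · by_contra hc
      have := Finset.prod_ne_zero_iff.1 h2 j (Finset.mem_erase.2 ⟨hj, Finset.mem_univ j⟩)
      simp [dampLT, hc] at this
  by_cases h : ∃ i, f i ≠ 0
  · obtain ⟨i, hi⟩ := h
    obtain ⟨hi0, hmax⟩ := hpos i hi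
    rw [Finset.sum_eq_single i]
    · refine le_trans (le_of_eq ?_) (ENNReal.ofReal_le_ofReal
        (invLaplace_mono hs (quality_le_sinr (W := W) i)))
      rw [invLaplace_quality hW hξ s hi0, invLaplace, if_pos hi0,
        ENNReal.ofReal_mul (Real.exp_nonneg _), ENNReal.ofReal_prod_of_nonneg
          fun _ _ => Real.exp_nonneg _]
      congr 1
      refine Finset.prod_congr rfl fun j hj => ?_
      rw [dampLT, if_pos ⟨hi0, hmax j (Finset.mem_erase.1 hj).1⟩]
    · intro k _ hki
      by_contra hk
      exact lt_asymm (hmax k hki) ((hpos k hk).2 i hki.symm)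
    · exact fun h => absurd (Finset.mem_univ i) h
  · push Not at h
    rw [Finset.sum_eq_zero fun i _ => h i]
    exact zero_le

lemma indicator_sinr_le_sum (hW : 0 < W) (hξ : ∀ i, 0 ≤ ξ.2 i) {A : Set ℝ} (hA : A ⊆ Set.Ioi 0) :
    A.indicator (fun _ => (1 : ℝ≥0∞)) (ξ.sinr W) ≤
      ∑ i, A.indicator (fun _ => 1) (ξ.2 i / (ξ.rest i + W)) := by
  by_cases h : ξ.sinr W ∈ A
  · obtain ⟨i, -, -, hQ⟩ := exists_strongest hW hξ (hA h)
    rw [hQ]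
    exact Finset.single_le_sum (f := fun i => A.indicator (fun _ => (1 : ℝ≥0∞))
      (ξ.2 i / (ξ.rest i + W))) (fun _ _ => zero_le) (Finset.mem_univ i)
  · rw [Set.indicator_of_notMem h]
    exact zero_le

/-- Two points cannot each exceed the sum of the others plus W, as each would then be larger than
the other. -/
lemma sum_indicator_lt_le_one (hW : 0 < W) (hξ : ∀ i, 0 ≤ ξ.2 i) :
    ∑ i, {q : ℝ × ℝ | q.2 + W < q.1}.indicator (fun _ => (1 : ℝ≥0∞)) (ξ.2 i, ξ.rest i) ≤ 1 := by
  by_cases h : ∃ i, ξ.rest i + W < ξ.2 i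
  · obtain ⟨i, hi⟩ := h
    rw [Finset.sum_eq_single i]
    · exact Set.indicator_le_self' (fun _ _ => zero_le) _ |>.trans le_rfl
    · intro k _ hki
      refine Set.indicator_of_notMem (fun hk => ?_) _
      have hk : ξ.rest k + W < ξ.2 k := hk
      linarith [le_rest hξ hki, le_rest hξ hki.symm]
    · exact fun h => absurd (Finset.mem_univ i) h
  · push Not at h
    refine (Finset.sum_eq_zero fun i _ => Set.indicator_of_notMem (fun hi => ?_) _).trans_le zero_le
    exact absurd (h i) (not_le.2 hi)

end FinConfig

/-! ### Integral bounds from Mecke's formula, and the normalization at s = 0. -/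

section Bounds

variable {μ : Measure ℝ} [IsProbabilityMeasure μ] {Λ : ℝ≥0} {W : ℝ}

lemma ae_nonneg_of_Iio {μ : Measure ℝ} (hμ : μ (Set.Iio 0) = 0) : ∀ᵐ p ∂μ, 0 ≤ p := by
  filter_upwards [compl_mem_ae_iff.2 hμ] with p hp
  exact not_lt.1 hp

/-- Mecke's formula integrates over the candidate x for the strongest point; the product over the
other points becomes the exponential by the generating functional. -/
lemma lintegral_invLaplace_le (hW : 0 < W) (hμ : μ (Set.Iio 0) = 0) {s : ℝ} (hs : 0 ≤ s) :
    ∫⁻ ξ, ENNReal.ofReal (invLaplace s (FinConfig.sinr W ξ)) ∂(poissonProcess μ Λ) ≤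
      Λ * ∫⁻ x, ENNReal.ofReal (invLaplace (s * W) x) *
        ENNReal.ofReal (Real.exp (-(Λ * exponentLE μ s x))) ∂μ := by
  simp_rw [exponentLE]
  rw [← lintegral_sum_prod (h := fun x => ENNReal.ofReal (invLaplace (s * W) x))
    (ENNReal.measurable_ofReal.comp (measurable_invLaplace _))
    (measurable_dampLE s) (dampLE_nonneg s) fun x => ?_]
  · refine lintegral_mono_ae ?_
    filter_upwards [ae_nonneg_poissonProcess hμ] with ξ hξ
    exact FinConfig.invLaplace_sinr_le_sum hW hξ s
  · filter_upwards [ae_nonneg_of_Iio hμ] with p hp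
    exact dampLE_le_one hs hp

lemma le_lintegral_invLaplace (hW : 0 < W) (hμ : μ (Set.Iio 0) = 0) {s : ℝ} (hs : 0 ≤ s) :
    Λ * ∫⁻ x, ENNReal.ofReal (invLaplace (s * W) x) *
        ENNReal.ofReal (Real.exp (-(Λ * exponentLT μ s x))) ∂μ ≤
    ∫⁻ ξ, ENNReal.ofReal (invLaplace s (FinConfig.sinr W ξ)) ∂(poissonProcess μ Λ) := by
  simp_rw [exponentLT]
  rw [← lintegral_sum_prod (h := fun x => ENNReal.ofReal (invLaplace (s * W) x))
    (ENNReal.measurable_ofReal.comp (measurable_invLaplace _))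
    (measurable_dampLT s) (dampLT_nonneg s) fun x => ?_]
  · refine lintegral_mono_ae ?_
    filter_upwards [ae_nonneg_poissonProcess hμ] with ξ hξ
    exact FinConfig.sum_le_invLaplace_sinr hW hξ hs
  · filter_upwards [ae_nonneg_of_Iio hμ] with p hp
    exact (dampLT_le_dampLE s x p).trans (dampLE_le_one hs hp)

/-- First-moment bound: the SINR is the quality of some point, and under Mecke's formula the
interference seen by that point is the total of a full process. -/
lemma measure_sinr_mem_le (hW : 0 < W) (hμ : μ (Set.Iio 0) = 0) {A : Set ℝ}
    (hAm : MeasurableSet A) (hA : A ⊆ Set.Ioi 0) :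
    poissonProcess μ Λ {ξ | ξ.sinr W ∈ A} ≤
      Λ * ∫⁻ ξ : FinConfig, μ {x | x / (ξ.total + W) ∈ A} ∂(poissonProcess μ Λ) := by
  have hF : Measurable fun q : ℝ × ℝ => A.indicator (fun _ => (1 : ℝ≥0∞)) (q.1 / (q.2 + W)) :=
    (measurable_const.indicator hAm).comp (by fun_prop)
  have h := lintegral_sum_rest (μ := μ) (Λ := Λ) hF
  have e1 : ∀ ξ : FinConfig, ∫⁻ x, A.indicator (fun _ => (1 : ℝ≥0∞)) (x / (ξ.total + W)) ∂μ =
      μ {x | x / (ξ.total + W) ∈ A} := by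
    intro ξ
    have hm : MeasurableSet {x : ℝ | x / (ξ.total + W) ∈ A} :=
      (measurable_id.div_const (ξ.total + W)) hAm
    rw [← lintegral_indicator_one hm]
    rfl
  simp only [e1] at h
  have hB : MeasurableSet {ξ : FinConfig | ξ.sinr W ∈ A} := (FinConfig.measurable_sinr W) hAm
  rw [← h, ← lintegral_indicator_one hB]
  refine lintegral_mono_ae ?_
  filter_upwards [ae_nonneg_poissonProcess hμ] with ξ hξ
  exact FinConfig.indicator_sinr_le_sum hW hξ hA

/-- The left side is the expected number of points exceeding the sum of the others plus W, which is
never more than one. It cancels the factor Λ whenever a tail is compared with the tail at total + W.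
-/
lemma lintegral_tail_total_le (hW : 0 < W) (hμ : μ (Set.Iio 0) = 0) :
    Λ * ∫⁻ ξ : FinConfig, μ (Set.Ioi (ξ.total + W)) ∂(poissonProcess μ Λ) ≤ 1 := by
  have hS : MeasurableSet {q : ℝ × ℝ | q.2 + W < q.1} :=
    measurableSet_lt (by fun_prop) (by fun_prop)
  have h := lintegral_sum_rest (μ := μ) (Λ := Λ)
    (F := {q : ℝ × ℝ | q.2 + W < q.1}.indicator fun _ => (1 : ℝ≥0∞))
    (measurable_const.indicator hS)
  have e1 : ∀ ξ : FinConfig, ∫⁻ x,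
      {q : ℝ × ℝ | q.2 + W < q.1}.indicator (fun _ => (1 : ℝ≥0∞)) (x, ξ.total) ∂μ =
      μ (Set.Ioi (ξ.total + W)) := by
    intro ξ
    rw [← lintegral_indicator_one measurableSet_Ioi]
    rfl
  simp only [e1] at h
  rw [← h]
  refine (lintegral_mono_ae ?_).trans (lintegral_one.trans measure_univ).le
  filter_upwards [ae_nonneg_poissonProcess hμ] with ξ hξ
  exact FinConfig.sum_indicator_lt_le_one hW hξ

lemma measure_forall_le (t : ℝ) :
    poissonProcess μ Λ {ξ | ∀ i, ξ.2 i ≤ t} =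
      ENNReal.ofReal (Real.exp (-(Λ * tailOf μ t))) := by
  have hm : MeasurableSet {ξ : FinConfig | ∀ i, ξ.2 i ≤ t} := by
    have : Measurable fun ξ : FinConfig => ∀ i, ξ.2 i ≤ t := by
      refine measurable_finConfig_iff.2 fun n => ?_
      show Measurable fun p : Fin n → ℝ => ∀ i, p i ≤ t
      exact Measurable.forall fun i => measurable_mem.2
        (measurableSet_le (measurable_pi_apply i) measurable_const)
    exact measurableSet_setOfPred.2 this
  have h := lintegral_prod_poissonProcess (μ := μ) (Λ := Λ)
    (g := (Set.Iic t).indicator fun _ => 1) (measurable_const.indicator measurableSet_Iic)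
    (a := μ.real (Set.Iic t)) measureReal_nonneg
    (by rw [lintegral_indicator_const measurableSet_Iic, one_mul, ofReal_measureReal])
  have e : 1 - μ.real (Set.Iic t) = tailOf μ t := by
    rw [tailOf, ← probReal_compl_eq_one_sub measurableSet_Iic, Set.compl_Iic]
  rw [← e, ← h, ← lintegral_indicator_one hm]
  refine lintegral_congr fun ξ => ?_
  by_cases hξ : ∀ i, ξ.2 i ≤ t
  · rw [Set.indicator_of_mem (show ξ ∈ {ξ : FinConfig | ∀ i, ξ.2 i ≤ t} from hξ),
      Finset.prod_eq_one fun i _ => Set.indicator_of_mem (Set.mem_Iic.2 (hξ i)) _]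
    rfl
  · rw [Set.indicator_of_notMem (show ξ ∉ {ξ : FinConfig | ∀ i, ξ.2 i ≤ t} from hξ)]
    push Not at hξ
    obtain ⟨i, hi⟩ := hξ
    exact (Finset.prod_eq_zero (Finset.mem_univ i)
      (Set.indicator_of_notMem (fun h => absurd (Set.mem_Iic.1 h) (not_le.2 hi)) _)).symm

lemma measure_total_le (hμ : μ (Set.Iio 0) = 0) (t : ℝ) :
    poissonProcess μ Λ {ξ | ξ.total ≤ t} ≤ ENNReal.ofReal (Real.exp (-(Λ * tailOf μ t))) := by
  rw [← measure_forall_le]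
  refine measure_mono_ae ?_
  filter_upwards [ae_nonneg_poissonProcess hμ] with ξ hξ h i
  have h : ξ.total ≤ t := h
  linarith [FinConfig.add_rest ξ i, FinConfig.rest_nonneg hξ i]

lemma exponentLE_zero {μ : Measure ℝ} {x : ℝ} (hx : 0 < x) : exponentLE μ 0 x = tailOf μ x := by
  have : ∀ p, 1 - dampLE 0 x p = (Set.Ioi x).indicator (fun _ => 1) p := by
    intro p
    by_cases hp : p ≤ x
    · simp [dampLE, hx, hp]
    · simp [dampLE, hp, lt_of_not_ge hp]
  simp_rw [exponentLE, this]
  rw [integral_indicator_const _ measurableSet_Ioi]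
  simp [tailOf]

lemma exponentLT_zero {μ : Measure ℝ} {x : ℝ} (hx : 0 < x) : exponentLT μ 0 x = μ.real (Set.Ici x) := by
  have : ∀ p, 1 - dampLT 0 x p = (Set.Ici x).indicator (fun _ => 1) p := by
    intro p
    by_cases hp : p < x
    · simp [dampLT, hx, hp]
    · simp [dampLT, hp, le_of_not_gt hp]
  simp_rw [exponentLT, this]
  rw [integral_indicator_const _ measurableSet_Ici]
  simp

/-- This replaces the substitution v = F̄(x), which fails for atoms. At s = 0 the upper Laplace
bound dominates the probability that some point is positive; the complement has the void
probability. The noise power 1 is arbitrary, as it drops out at s = 0. -/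
lemma one_le_lintegral_tail (hμ : μ (Set.Iio 0) = 0) :
    1 ≤ ENNReal.ofReal (Real.exp (-(Λ * tailOf μ 0))) +
      Λ * ∫⁻ x in Set.Ioi 0, ENNReal.ofReal (Real.exp (-(Λ * tailOf μ x))) ∂μ := by
  have h1 := lintegral_invLaplace_le (μ := μ) (Λ := Λ) one_pos hμ le_rfl
  have e : ∀ x, ENNReal.ofReal (invLaplace (0 * 1) x) *
        ENNReal.ofReal (Real.exp (-(Λ * exponentLE μ 0 x))) =
        (Set.Ioi 0).indicator (fun x => ENNReal.ofReal (Real.exp (-(Λ * tailOf μ x)))) x := by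
    intro x
    by_cases hx : 0 < x
    · simp [invLaplace, hx, exponentLE_zero hx]
    · simp [invLaplace, hx]
  simp_rw [e] at h1
  rw [lintegral_indicator measurableSet_Ioi] at h1
  refine le_trans ?_ (add_le_add_right h1 _)
  rw [← measure_forall_le, ← measure_univ (μ := poissonProcess μ Λ)]
  have hm : Measurable fun ξ : FinConfig => ENNReal.ofReal (invLaplace 0 (ξ.sinr 1)) :=
    ENNReal.measurable_ofReal.comp ((measurable_invLaplace 0).comp (FinConfig.measurable_sinr 1))
  have h2 : poissonProcess μ Λ {ξ | 1 ≤ ENNReal.ofReal (invLaplace 0 (ξ.sinr 1))} ≤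
      ∫⁻ ξ, ENNReal.ofReal (invLaplace 0 (ξ.sinr 1)) ∂(poissonProcess μ Λ) := by
    simpa using mul_meas_ge_le_lintegral hm 1
  refine le_trans ?_ (add_le_add_right h2 _)
  refine le_trans (measure_mono_ae ?_) (measure_union_le _ _)
  filter_upwards [ae_nonneg_poissonProcess hμ] with ξ hξ _
  by_cases h : ∀ i, ξ.2 i ≤ 0
  · exact Or.inl h
  · right
    push Not at h
    obtain ⟨i, hi⟩ := h
    have : 0 < ξ.sinr 1 := lt_of_lt_of_le
      (div_pos hi (by linarith [FinConfig.rest_nonneg hξ i])) (FinConfig.quality_le_sinr i)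
    change 1 ≤ ENNReal.ofReal (invLaplace 0 (ξ.sinr 1))
    simp [invLaplace, this]

/-- At s = 0 the lower Laplace bound is the probability of a unique positive maximum. Strict
domination by x excludes points equal to x, hence the closed half-line. -/
lemma lintegral_tail_le_one (hμ : μ (Set.Iio 0) = 0) :
    Λ * ∫⁻ x in Set.Ioi 0, ENNReal.ofReal (Real.exp (-(Λ * μ.real (Set.Ici x)))) ∂μ ≤ 1 := by
  have h1 := le_lintegral_invLaplace (μ := μ) (Λ := Λ) one_pos hμ le_rfl
  have e : ∀ x, ENNReal.ofReal (invLaplace (0 * 1) x) *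
        ENNReal.ofReal (Real.exp (-(Λ * exponentLT μ 0 x))) =
        (Set.Ioi 0).indicator (fun x => ENNReal.ofReal (Real.exp (-(Λ * μ.real (Set.Ici x))))) x := by
    intro x
    by_cases hx : 0 < x
    · simp [invLaplace, hx, exponentLT_zero hx]
    · simp [invLaplace, hx]
  simp_rw [e] at h1
  rw [lintegral_indicator measurableSet_Ioi] at h1
  refine h1.trans (le_trans (lintegral_mono fun ξ => ?_) (lintegral_one.trans measure_univ).le)
  exact ENNReal.ofReal_le_one.2 (invLaplace_le_one le_rfl _)

end Bounds

/-! ### Regularly varying tails -/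

lemma antitone_two_pow_le {h : ℝ → ℝ} {c x₀ x : ℝ} (hc : 0 ≤ c) (hx₀ : 0 < x₀)
    (h2 : ∀ x, x₀ ≤ x → h (2 * x) ≤ c * h x) (hx : x₀ ≤ x) (n : ℕ) :
    h (2 ^ n * x) ≤ c ^ n * h x := by
  induction n with
  | zero => simp
  | succ n ih =>
    have h1 : x₀ ≤ 2 ^ n * x := by
      have : (1 : ℝ) ≤ 2 ^ n := one_le_pow₀ (by norm_num)
      nlinarith
    calc h (2 ^ (n + 1) * x) = h (2 * (2 ^ n * x)) := by ring_nf
      _ ≤ c * h (2 ^ n * x) := h2 _ h1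
      _ ≤ c * (c ^ n * h x) := mul_le_mul_of_nonneg_left ih hc
      _ = c ^ (n + 1) * h x := by ring

lemma le_antitone_two_pow {h : ℝ → ℝ} {c x₀ x : ℝ} (hc : 0 ≤ c) (hx₀ : 0 < x₀)
    (h2 : ∀ x, x₀ ≤ x → c * h x ≤ h (2 * x)) (hx : x₀ ≤ x) (n : ℕ) :
    c ^ n * h x ≤ h (2 ^ n * x) := by
  have := antitone_two_pow_le (h := fun x => -h x) hc hx₀
    (fun x hx => by simpa using h2 x hx) hx n
  simpa using this

lemma two_rpow_neg_pow (δ : ℝ) (n : ℕ) : ((2 : ℝ) ^ (-δ)) ^ n = ((2 : ℝ) ^ n) ^ (-δ) := by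
  rw [← Real.rpow_natCast, ← Real.rpow_mul (by norm_num), mul_comm, Real.rpow_mul (by norm_num),
    Real.rpow_natCast]

/-- Upper Potter bound for a monotone function. -/
lemma Antitone.potter_upper {h : ℝ → ℝ} (hh : Antitone h) (h0 : ∀ x, 0 ≤ h x) {δ x₀ : ℝ}
    (hδ : 0 ≤ δ) (hx₀ : 0 < x₀) (h2 : ∀ x, x₀ ≤ x → h (2 * x) ≤ 2 ^ (-δ) * h x) {x y : ℝ}
    (hx : x₀ ≤ x) (hy : 1 ≤ y) : h (y * x) ≤ (y / 2) ^ (-δ) * h x := by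
  obtain ⟨n, hn1, hn2⟩ := exists_nat_pow_near hy (by norm_num : (1 : ℝ) < 2)
  have hx0 : 0 ≤ x := hx₀.le.trans hx
  calc h (y * x) ≤ h (2 ^ n * x) := hh (mul_le_mul_of_nonneg_right hn1 hx0)
    _ ≤ ((2 : ℝ) ^ (-δ)) ^ n * h x := antitone_two_pow_le (by positivity) hx₀ h2 hx n
    _ ≤ (y / 2) ^ (-δ) * h x := by
      refine mul_le_mul_of_nonneg_right ?_ (h0 x)
      rw [two_rpow_neg_pow]
      refine Real.rpow_le_rpow_of_nonpos (by positivity) ?_ (by linarith)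
      rw [pow_succ] at hn2
      linarith

/-- Lower Potter bound for a monotone function. -/
lemma Antitone.potter_lower {h : ℝ → ℝ} (hh : Antitone h) (h0 : ∀ x, 0 ≤ h x) {γ x₀ : ℝ}
    (hγ : 0 ≤ γ) (hx₀ : 0 < x₀) (h2 : ∀ x, x₀ ≤ x → 2 ^ (-γ) * h x ≤ h (2 * x)) {x y : ℝ}
    (hx : x₀ ≤ x) (hy : 1 ≤ y) : (2 * y) ^ (-γ) * h x ≤ h (y * x) := by
  obtain ⟨n, hn1, hn2⟩ := exists_nat_pow_near hy (by norm_num : (1 : ℝ) < 2)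
  have hx0 : 0 ≤ x := hx₀.le.trans hx
  calc (2 * y) ^ (-γ) * h x ≤ ((2 : ℝ) ^ (-γ)) ^ (n + 1) * h x := by
        refine mul_le_mul_of_nonneg_right ?_ (h0 x)
        rw [two_rpow_neg_pow]
        refine Real.rpow_le_rpow_of_nonpos (by positivity) ?_ (by linarith)
        rw [pow_succ]
        linarith
    _ ≤ h (2 ^ (n + 1) * x) := le_antitone_two_pow (by positivity) hx₀ h2 hx _
    _ ≤ h (y * x) := hh (mul_le_mul_of_nonneg_right hn2.le hx0)

lemma tailOf_nonneg (μ : Measure ℝ) (t : ℝ) : 0 ≤ tailOf μ t := measureReal_nonneg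

lemma tailOf_antitone (μ : Measure ℝ) [IsFiniteMeasure μ] : Antitone (tailOf μ) :=
  fun _ _ h => measureReal_mono (Set.Ioi_subset_Ioi h)

lemma tailOf_le_one (μ : Measure ℝ) [IsProbabilityMeasure μ] (t : ℝ) : tailOf μ t ≤ 1 :=
  measureReal_le_one

lemma ofReal_tailOf (μ : Measure ℝ) [IsFiniteMeasure μ] (t : ℝ) :
    ENNReal.ofReal (tailOf μ t) = μ (Set.Ioi t) := ofReal_measureReal

namespace RegularlyVarying

variable {μ : Measure ℝ} [IsProbabilityMeasure μ] {α : ℝ}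

lemma tail_pos (hF : RegularlyVarying (tailOf μ) (-α)) (x : ℝ) : 0 < tailOf μ x :=
  (hF.1.1 (max x 1) (by positivity)).trans_le (tailOf_antitone μ (le_max_left _ _))

lemma exists_two_mul_le {h : ℝ → ℝ} (hF : RegularlyVarying h (-α)) {δ : ℝ} (hδ : δ < α) :
    ∃ x₀ : ℝ, 0 < x₀ ∧ ∀ x, x₀ ≤ x → h (2 * x) ≤ 2 ^ (-δ) * h x := by
  have h1 : (2 : ℝ) ^ (-α) < 2 ^ (-δ) := Real.rpow_lt_rpow_of_exponent_lt (by norm_num) (by linarith)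
  obtain ⟨x₀, hx₀⟩ := eventually_atTop.1 ((hF.2 2 (by norm_num)).eventually_lt_const h1)
  refine ⟨max x₀ 1, by positivity, fun x hx => ?_⟩
  have h2 := hx₀ x ((le_max_left _ _).trans hx)
  rw [div_lt_iff₀ (hF.1.1 x (by linarith [le_max_right x₀ 1]))] at h2
  exact h2.le

lemma exists_le_two_mul {h : ℝ → ℝ} (hF : RegularlyVarying h (-α)) {γ : ℝ} (hγ : α < γ) :
    ∃ x₀ : ℝ, 0 < x₀ ∧ ∀ x, x₀ ≤ x → 2 ^ (-γ) * h x ≤ h (2 * x) := by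
  have h1 : (2 : ℝ) ^ (-γ) < 2 ^ (-α) := Real.rpow_lt_rpow_of_exponent_lt (by norm_num) (by linarith)
  obtain ⟨x₀, hx₀⟩ := eventually_atTop.1 ((hF.2 2 (by norm_num)).eventually_const_lt h1)
  refine ⟨max x₀ 1, by positivity, fun x hx => ?_⟩
  have h2 := hx₀ x ((le_max_left _ _).trans hx)
  rw [lt_div_iff₀ (hF.1.1 x (by linarith [le_max_right x₀ 1]))] at h2
  exact h2.le

/-- The Potter bound covers u * x ≥ x₀. For smaller u * x the tail is at most 1, and the lower
Potter bound from x₀ to x shows that the tail at x is not too small; this costs the factor 1 /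
`tailOf μ x₀`. The uniformity down to u = 0 provides a dominating function. -/
lemma exists_tail_mul_le_small (hF : RegularlyVarying (tailOf μ) (-α)) {γ : ℝ} (hγ0 : 0 ≤ γ)
    (hγ : α < γ) : ∃ C x₀ : ℝ, 0 < C ∧ 0 < x₀ ∧ ∀ x u, x₀ ≤ x → 0 < u → u ≤ 1 →
      tailOf μ (u * x) ≤ C * u ^ (-γ) * tailOf μ x := by
  obtain ⟨x₀, hx₀, h2⟩ := hF.exists_le_two_mul hγ
  have key : ∀ x y, x₀ ≤ x → 1 ≤ y → tailOf μ x ≤ (2 * y) ^ γ * tailOf μ (y * x) := by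
    intro x y hx hy
    have := (tailOf_antitone μ).potter_lower (tailOf_nonneg μ) hγ0 hx₀ h2 hx hy
    rwa [Real.rpow_neg (by positivity), inv_mul_le_iff₀ (by positivity)] at this
  have hT := hF.tail_pos x₀
  have hT1 := tailOf_le_one μ x₀
  refine ⟨2 ^ γ / tailOf μ x₀, x₀, by positivity, hx₀, fun x u hx hu hu1 => ?_⟩
  have hx0 : 0 < x := hx₀.trans_le hx
  have e : (2 * u⁻¹) ^ γ = 2 ^ γ * u ^ (-γ) := by
    rw [Real.mul_rpow (by norm_num) (by positivity), Real.inv_rpow hu.le, Real.rpow_neg hu.le]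
  have hC : (2 * u⁻¹) ^ γ ≤ 2 ^ γ / tailOf μ x₀ * u ^ (-γ) := by
    rw [e]
    refine mul_le_mul_of_nonneg_right ?_ (by positivity)
    rw [le_div_iff₀ hT]
    exact mul_le_of_le_one_right (by positivity) hT1
  by_cases hux : x₀ ≤ u * x
  · have := key (u * x) u⁻¹ hux ((one_le_inv₀ hu).2 hu1)
    rw [inv_mul_cancel_left₀ hu.ne'] at this
    exact this.trans (mul_le_mul_of_nonneg_right hC (tailOf_nonneg μ x))
  · push Not at hux
    have h3 := key x₀ (x / x₀) le_rfl ((one_le_div hx₀).2 hx)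
    rw [div_mul_cancel₀ _ hx₀.ne'] at h3
    have h4 : (2 * (x / x₀)) ^ γ ≤ (2 * u⁻¹) ^ γ := by
      refine Real.rpow_le_rpow (by positivity) ?_ hγ0
      have : x / x₀ ≤ u⁻¹ := by
        rw [div_le_iff₀ hx₀, ← div_eq_inv_mul, le_div_iff₀ hu]
        linarith
      linarith
    calc tailOf μ (u * x) ≤ 1 := tailOf_le_one μ _
      _ = tailOf μ x₀ / tailOf μ x₀ := (div_self hT.ne').symm
      _ ≤ (2 * u⁻¹) ^ γ * tailOf μ x / tailOf μ x₀ := by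
        refine div_le_div_of_nonneg_right ?_ hT.le
        exact h3.trans (mul_le_mul_of_nonneg_right h4 (tailOf_nonneg μ x))
      _ = 2 ^ γ / tailOf μ x₀ * u ^ (-γ) * tailOf μ x := by
        rw [e]
        ring

/-- The bound must hold for every z ≥ W, since it is used at z = total + W. The factor b lifts all
such z beyond x₀; for y < b monotonicity suffices because the constant already exceeds what is
needed. -/
lemma exists_tail_mul_le_large (hF : RegularlyVarying (tailOf μ) (-α)) {δ W : ℝ} (hδ0 : 0 ≤ δ)
    (hδ : δ < α) (hW : 0 < W) : ∃ C : ℝ, 0 < C ∧ ∀ z y, W ≤ z → 1 ≤ y →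
      tailOf μ (y * z) ≤ C * y ^ (-δ) * tailOf μ z := by
  obtain ⟨x₀, hx₀, h2⟩ := hF.exists_two_mul_le hδ
  have key : ∀ x y, x₀ ≤ x → 1 ≤ y → tailOf μ (y * x) ≤ (y / 2) ^ (-δ) * tailOf μ x := by
    intro x y hx hy
    exact (tailOf_antitone μ).potter_upper (tailOf_nonneg μ) hδ0 hx₀ h2 hx hy
  set b := max x₀ W / W with hb
  have hb1 : 1 ≤ b := (one_le_div hW).2 (le_max_right _ _)
  have hb0 : x₀ ≤ b * W := by
    rw [hb, div_mul_cancel₀ _ hW.ne']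
    exact le_max_left _ _
  refine ⟨(2 * b) ^ δ, by positivity, fun z y hz hy => ?_⟩
  have hz0 : 0 < z := hW.trans_le hz
  have hy0 : 0 < y := by linarith
  have hbz : x₀ ≤ b * z := hb0.trans (mul_le_mul_of_nonneg_left hz (by linarith))
  have e : (2 * b) ^ δ * y ^ (-δ) = (y / b / 2) ^ (-δ) := by
    rw [div_div, mul_comm b 2, Real.div_rpow hy0.le (by positivity), Real.rpow_neg (by positivity) δ,
      Real.rpow_neg (by positivity) δ, div_inv_eq_mul, mul_comm]
  rw [e]
  by_cases hyb : b ≤ y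
  · have h3 := key (b * z) (y / b) hbz ((one_le_div (by linarith)).2 hyb)
    rw [← mul_assoc, div_mul_cancel₀ _ (by linarith)] at h3
    refine h3.trans (mul_le_mul_of_nonneg_left (tailOf_antitone μ ?_) (by positivity))
    nlinarith
  · push Not at hyb
    have h3 : tailOf μ (y * z) ≤ tailOf μ z := tailOf_antitone μ (by nlinarith)
    refine h3.trans (le_mul_of_one_le_left (tailOf_nonneg μ z) ?_)
    refine Real.one_le_rpow_of_pos_of_le_one_of_nonpos (by positivity) ?_ (by linarith)
    rw [div_div, div_le_one (by positivity)]
    linarith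

/-- Atoms are negligible relative to the tail: [x, ∞) lies in (tx, ∞) for every t < 1, and t ^ (-α)
→ 1 as t increases to 1. -/
lemma tendsto_tail_Ici (hF : RegularlyVarying (tailOf μ) (-α)) :
    Tendsto (fun x => μ.real (Set.Ici x) / tailOf μ x) atTop (𝓝 1) := by
  have hc : Tendsto (fun t : ℝ => t ^ (-α)) (𝓝[<] 1) (𝓝 1) := by
    have : ContinuousAt (fun t : ℝ => t ^ (-α)) 1 :=
      Real.continuousAt_rpow_const 1 _ (Or.inl one_ne_zero)
    simpa using this.tendsto.mono_left nhdsWithin_le_nhds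
  refine tendsto_order.2 ⟨fun a ha => Eventually.of_forall fun x => ha.trans_le ?_, fun a ha => ?_⟩
  · rw [one_le_div (hF.tail_pos x)]
    exact measureReal_mono Set.Ioi_subset_Ici_self
  · have h1 : ∀ᶠ t : ℝ in 𝓝[<] 1, 0 < t ∧ t < 1 :=
      Ioo_mem_nhdsLT (by norm_num : (0 : ℝ) < 1)
    obtain ⟨t, hta, ht0, ht1⟩ := ((hc.eventually_lt_const ha).and h1).exists
    filter_upwards [(hF.2 t ht0).eventually_lt_const hta, eventually_gt_atTop 0] with x hx hx0
    refine lt_of_le_of_lt ?_ hx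
    refine div_le_div_of_nonneg_right (measureReal_mono fun z hz => ?_) (tailOf_nonneg μ x)
    have hz : x ≤ z := hz
    have : t * x < x := by nlinarith
    exact this.trans_le hz

end RegularlyVarying

/-- The limit of the Laplace exponents of the relative interference for a tail of index `-α`. -/
def limitExponent (α s : ℝ) : ℝ :=
  Real.exp (-s) + ∫ u in Set.Ioc (0 : ℝ) 1, s * Real.exp (-(s * u)) * u ^ (-α)

lemma limitExponent_pos (α : ℝ) {s : ℝ} (hs : 0 ≤ s) : 0 < limitExponent α s := by
  refine add_pos_of_pos_of_nonneg (Real.exp_pos _) ?_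
  refine setIntegral_nonneg measurableSet_Ioc fun u hu => ?_
  have := Real.rpow_nonneg hu.1.le (-α)
  positivity

lemma integral_Ioc_exp (s : ℝ) {c : ℝ} (hc : 0 ≤ c) :
    ∫ u in Set.Ioc 0 c, s * Real.exp (-(s * u)) = 1 - Real.exp (-(s * c)) := by
  rw [← intervalIntegral.integral_of_le hc]
  have hd : ∀ u ∈ Set.uIcc 0 c,
      HasDerivAt (fun u => -Real.exp (-(s * u))) (s * Real.exp (-(s * u))) u := by
    intro u _
    have h1 : HasDerivAt (fun u => -(s * u)) (-(s * 1)) u := ((hasDerivAt_id u).const_mul s).neg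
    convert! h1.exp.neg using 1
    ring
  rw [intervalIntegral.integral_eq_sub_of_hasDerivAt hd
    (Continuous.intervalIntegrable (by fun_prop) _ _)]
  simp
  ring

/-- At α = 0 the dependence on s disappears: the largest power outweighs the sum of all others, so
that 1/SINR tends to 0. -/
lemma limitExponent_zero (s : ℝ) : limitExponent 0 s = 1 := by
  simp [limitExponent, integral_Ioc_exp s zero_le_one]

/-- Layer-cake form: 1 - exp(-sp/x) is the integral of s exp(-su) over u < p/x. For p > x the left
side is 1, and the integral up to u = 1 misses exactly exp(-s). -/
lemma one_sub_dampLE {s x p : ℝ} (hx : 0 < x) (hp : 0 ≤ p) :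
    1 - dampLE s x p = Real.exp (-s) * (Set.Ioi x).indicator (fun _ => 1) p +
      ∫ u in Set.Ioc (0 : ℝ) 1,
        s * Real.exp (-(s * u)) * (Set.Ioi (u * x)).indicator (fun _ => 1) p := by
  have h1 : ∀ u, s * Real.exp (-(s * u)) * (Set.Ioi (u * x)).indicator (fun _ => 1) p =
      (Set.Iio (p / x)).indicator (fun u => s * Real.exp (-(s * u))) u := by
    intro u
    by_cases h : u * x < p
    · rw [Set.indicator_of_mem (Set.mem_Ioi.2 h),
        Set.indicator_of_mem (Set.mem_Iio.2 ((lt_div_iff₀ hx).2 h)), mul_one]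
    · rw [Set.indicator_of_notMem (fun h' => h (Set.mem_Ioi.1 h')),
        Set.indicator_of_notMem (fun h' => h ((lt_div_iff₀ hx).1 (Set.mem_Iio.1 h'))), mul_zero]
  simp_rw [h1]
  rw [setIntegral_indicator measurableSet_Iio]
  by_cases hpx : p ≤ x
  · have e : Set.Ioc (0 : ℝ) 1 ∩ Set.Iio (p / x) = Set.Ioo 0 (p / x) := by
      ext u
      have := (div_le_one hx).2 hpx
      simp only [Set.mem_inter_iff, Set.mem_Ioc, Set.mem_Iio, Set.mem_Ioo]
      constructor
      · exact fun h => ⟨h.1.1, h.2⟩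
      · exact fun h => ⟨⟨h.1, (h.2.trans_le this).le⟩, h.2⟩
    rw [e, ← integral_Ioc_eq_integral_Ioo, integral_Ioc_exp s (div_nonneg hp hx.le),
      Set.indicator_of_notMem (fun h => absurd (Set.mem_Ioi.1 h) (not_lt.2 hpx)), dampLE,
      if_pos ⟨hx, hpx⟩]
    ring_nf
  · have hpx' := not_le.1 hpx
    have e : Set.Ioc (0 : ℝ) 1 ∩ Set.Iio (p / x) = Set.Ioc 0 1 := by
      refine Set.inter_eq_left.2 fun u hu => ?_
      exact hu.2.trans_lt ((one_lt_div hx).2 hpx')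
    rw [e, integral_Ioc_exp s zero_le_one, Set.indicator_of_mem (Set.mem_Ioi.2 hpx'), dampLE,
      if_neg (fun h => hpx h.2)]
    ring_nf

/-! ### Asymptotics of the Laplace exponents. -/

section Exponent

variable {μ : Measure ℝ} [IsProbabilityMeasure μ]

lemma integrable_dampLE (hμ : μ (Set.Iio 0) = 0) {s : ℝ} (hs : 0 ≤ s) (x : ℝ) :
    Integrable (dampLE s x) μ := by
  refine Integrable.of_bound ((measurable_dampLE s).comp
    (measurable_const.prodMk measurable_id)).aestronglyMeasurable 1 ?_
  filter_upwards [ae_nonneg_of_Iio hμ] with p hp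
  rw [Real.norm_of_nonneg (dampLE_nonneg s x p)]
  exact dampLE_le_one hs hp

/-- Fubini applied to the layer-cake form writes the exponent through values of the tail alone, to
which regular variation applies. -/
lemma exponentLE_eq (hμ : μ (Set.Iio 0) = 0) {s x : ℝ} (hx : 0 < x) :
    exponentLE μ s x = Real.exp (-s) * tailOf μ x +
      ∫ u in Set.Ioc (0 : ℝ) 1, s * Real.exp (-(s * u)) * tailOf μ (u * x) := by
  have hind : ∀ t, ∫ p, (Set.Ioi t).indicator (fun _ => (1 : ℝ)) p ∂μ = tailOf μ t := by
    intro t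
    rw [integral_indicator_const _ measurableSet_Ioi]
    simp [tailOf]
  have hae : ∀ᵐ p ∂μ, 1 - dampLE s x p = Real.exp (-s) * (Set.Ioi x).indicator (fun _ => 1) p +
      ∫ u in Set.Ioc (0 : ℝ) 1,
        s * Real.exp (-(s * u)) * (Set.Ioi (u * x)).indicator (fun _ => 1) p := by
    filter_upwards [ae_nonneg_of_Iio hμ] with p hp
    exact one_sub_dampLE hx hp
  have hS : MeasurableSet {q : ℝ × ℝ | q.2 * x < q.1} := measurableSet_lt (by fun_prop) (by fun_prop)
  have hint : Integrable (fun q : ℝ × ℝ => s * Real.exp (-(s * q.2)) *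
      {q : ℝ × ℝ | q.2 * x < q.1}.indicator (fun _ => (1 : ℝ)) q)
      (μ.prod (volume.restrict (Set.Ioc 0 1))) := by
    have h1 : Integrable (fun u : ℝ => s * Real.exp (-(s * u))) (volume.restrict (Set.Ioc 0 1)) :=
      ((by fun_prop : Continuous fun u : ℝ => s * Real.exp (-(s * u))).integrableOn_Icc
        (a := 0) (b := 1)).mono_set Set.Ioc_subset_Icc_self
    refine (h1.comp_snd μ).mul_bdd (c := 1)
      (measurable_const.indicator hS).aestronglyMeasurable (ae_of_all _ fun q => ?_)
    by_cases hq : q ∈ {q : ℝ × ℝ | q.2 * x < q.1}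
    · rw [Set.indicator_of_mem hq]; simp
    · rw [Set.indicator_of_notMem hq]; simp
  rw [exponentLE, integral_congr_ae hae, integral_add, integral_const_mul, hind]
  · congr 1
    have := integral_integral_swap (f := fun p u => s * Real.exp (-(s * u)) *
      {q : ℝ × ℝ | q.2 * x < q.1}.indicator (fun _ => (1 : ℝ)) (p, u)) hint
    refine this.trans (integral_congr_ae (ae_of_all _ fun u => ?_))
    change ∫ p, s * Real.exp (-(s * u)) * (Set.Ioi (u * x)).indicator (fun _ => 1) p ∂μ = _
    rw [integral_const_mul, hind]
  · exact ((integrable_const 1).indicator measurableSet_Ioi).const_mul _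
  · exact hint.integral_prod_left

lemma RegularlyVarying.tendsto_exponentLE {α : ℝ} (hF : RegularlyVarying (tailOf μ) (-α))
    (hμ : μ (Set.Iio 0) = 0) (hα0 : 0 ≤ α) (hα1 : α < 1) {s : ℝ} (hs : 0 ≤ s) :
    Tendsto (fun x => exponentLE μ s x / tailOf μ x) atTop (𝓝 (limitExponent α s)) := by
  -- An exponent strictly between α and 1: above α for the Potter bound, below 1 so that the
  -- majorant is integrable at 0.
  obtain ⟨C, x₀, hC, hx₀, hb⟩ := hF.exists_tail_mul_le_small (γ := (α + 1) / 2) (by linarith)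
    (by linarith)
  have hlim : Tendsto (fun x => ∫ u in Set.Ioc (0 : ℝ) 1,
      s * Real.exp (-(s * u)) * (tailOf μ (u * x) / tailOf μ x)) atTop
      (𝓝 (∫ u in Set.Ioc (0 : ℝ) 1, s * Real.exp (-(s * u)) * u ^ (-α))) := by
    refine tendsto_integral_filter_of_dominated_convergence
      (fun u => s * (C * u ^ (-((α + 1) / 2)))) ?_ ?_ ?_ ?_
    · refine Eventually.of_forall fun x => Measurable.aestronglyMeasurable ?_
      have : Measurable (tailOf μ) := (tailOf_antitone μ).measurable
      fun_prop
    · filter_upwards [eventually_ge_atTop x₀] with x hx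
      filter_upwards [ae_restrict_mem measurableSet_Ioc] with u hu
      have hT := hF.tail_pos x
      have h1 := tailOf_nonneg μ (u * x)
      rw [Real.norm_of_nonneg (by positivity)]
      have h2 : Real.exp (-(s * u)) ≤ 1 :=
        Real.exp_le_one_iff.2 (neg_nonpos.2 (mul_nonneg hs hu.1.le))
      have h3 : tailOf μ (u * x) / tailOf μ x ≤ C * u ^ (-((α + 1) / 2)) :=
        (div_le_iff₀ hT).2 (hb x u hx hu.1 hu.2)
      calc s * Real.exp (-(s * u)) * (tailOf μ (u * x) / tailOf μ x)
          ≤ s * 1 * (C * u ^ (-((α + 1) / 2))) := by gcongr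
        _ = _ := by ring
    · refine Integrable.const_mul (Integrable.const_mul ?_ _) _
      have := intervalIntegral.intervalIntegrable_rpow' (a := 0) (b := 1)
        (r := -((α + 1) / 2)) (by linarith)
      rwa [intervalIntegrable_iff_integrableOn_Ioc_of_le zero_le_one] at this
    · filter_upwards [ae_restrict_mem measurableSet_Ioc] with u hu
      exact (hF.2 u hu.1).const_mul _
  refine (hlim.const_add (Real.exp (-s))).congr' ?_
  filter_upwards [eventually_gt_atTop 0] with x hx
  have hT := hF.tail_pos x
  rw [exponentLE_eq hμ hx, add_div, mul_div_cancel_right₀ _ hT.ne', ← integral_div]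
  simp_rw [mul_div_assoc]

/-- The two exponents differ only through the atom at p = x, whose mass is the last bracket. -/
lemma exponentLT_le (hμ : μ (Set.Iio 0) = 0) {s x : ℝ} (hs : 0 ≤ s) :
    exponentLT μ s x ≤ exponentLE μ s x + (μ.real (Set.Ici x) - tailOf μ x) := by
  have e : μ.real (Set.Ici x) - tailOf μ x = ∫ p, ({x} : Set ℝ).indicator (fun _ => (1 : ℝ)) p ∂μ := by
    rw [integral_indicator_const _ (measurableSet_singleton x), tailOf,
      ← Set.Ioi_union_left, measureReal_union (by simp) (measurableSet_singleton x)]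
    simp
  have hle := integrable_dampLE hμ hs x
  have hlt : Integrable (dampLT s x) μ := hle.mono'
    ((measurable_dampLT s).comp (measurable_const.prodMk measurable_id)).aestronglyMeasurable
    (ae_of_all _ fun p => by
      rw [Real.norm_of_nonneg (dampLT_nonneg s x p)]
      exact dampLT_le_dampLE s x p)
  have hi : Integrable (({x} : Set ℝ).indicator fun _ => (1 : ℝ)) μ :=
    (integrable_const 1).indicator (measurableSet_singleton x)
  have hle' : Integrable (fun p => 1 - dampLE s x p) μ := (integrable_const 1).sub hle
  have hlt' : Integrable (fun p => 1 - dampLT s x p) μ := (integrable_const 1).sub hlt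
  rw [e, exponentLE, exponentLT, ← integral_add hle' hi]
  refine integral_mono_ae hlt' (hle'.add hi) ?_
  filter_upwards [ae_nonneg_of_Iio hμ] with p hp
  change 1 - dampLT s x p ≤ 1 - dampLE s x p + ({x} : Set ℝ).indicator (fun _ => 1) p
  by_cases hpx : p = x
  · subst hpx
    rw [Set.indicator_of_mem (Set.mem_singleton p)]
    linarith [dampLE_le_one (x := p) hs hp, dampLT_nonneg s p p]
  · rw [Set.indicator_of_notMem (show p ∉ ({x} : Set ℝ) from hpx), add_zero]
    have : dampLT s x p = dampLE s x p := by
      unfold dampLT dampLE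
      congr 1
      exact propext (and_congr_right fun _ => ⟨le_of_lt, fun h => lt_of_le_of_ne h hpx⟩)
    rw [this]

end Exponent

/-! ### Limit of the Laplace transform of the inverse SINR. -/

section LaplaceLimit

variable {μ : Measure ℝ} [IsProbabilityMeasure μ] {W : ℝ}

lemma tailOf_le_exponentLE (hμ : μ (Set.Iio 0) = 0) {s x : ℝ} (hs : 0 ≤ s) (hx : 0 < x) :
    tailOf μ x ≤ exponentLE μ s x := by
  rw [← exponentLE_zero hx]
  refine integral_mono_ae ((integrable_const 1).sub (integrable_dampLE hμ le_rfl x))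
    ((integrable_const 1).sub (integrable_dampLE hμ hs x)) ?_
  filter_upwards [ae_nonneg_of_Iio hμ] with p hp
  refine sub_le_sub_left ?_ 1
  unfold dampLE
  split_ifs
  · refine Real.exp_le_exp.2 (neg_le_neg ?_)
    rw [zero_mul, zero_div]
    positivity
  · exact le_rfl

/-- The contribution of the points below a fixed level. -/
lemma setLIntegral_Ioc_exp_le (Λ : ℝ≥0) (x₀ : ℝ) {f : ℝ → ℝ}
    (hf : ∀ x, 0 < x → x ≤ x₀ → tailOf μ x₀ ≤ f x) :
    Λ * ∫⁻ x in Set.Ioc 0 x₀, ENNReal.ofReal (Real.exp (-(Λ * f x))) ∂μ ≤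
      ENNReal.ofReal (Λ * Real.exp (-(Λ * tailOf μ x₀))) := by
  rw [ENNReal.ofReal_mul Λ.coe_nonneg, ENNReal.ofReal_coe_nnreal]
  refine mul_le_mul_right ?_ _
  calc ∫⁻ x in Set.Ioc 0 x₀, ENNReal.ofReal (Real.exp (-(Λ * f x))) ∂μ
      ≤ ∫⁻ x in Set.Ioc 0 x₀, ENNReal.ofReal (Real.exp (-(Λ * tailOf μ x₀))) ∂μ := by
        refine setLIntegral_mono measurable_const fun x hx => ?_
        refine ENNReal.ofReal_le_ofReal (Real.exp_le_exp.2 (neg_le_neg ?_))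
        exact mul_le_mul_of_nonneg_left (hf x hx.1 hx.2) Λ.coe_nonneg
    _ ≤ ENNReal.ofReal (Real.exp (-(Λ * tailOf μ x₀))) := by
        rw [setLIntegral_const]
        exact mul_le_of_le_one_right' prob_le_one

/-- Beyond x₀ the integrand is at most that of the s = 0 bound for a process of mean kΛ, which
yields 1/k. The part below x₀ is exponentially small in Λ. -/
lemma lintegral_invLaplace_le_of_exponent (hW : 0 < W) (hμ : μ (Set.Iio 0) = 0) {s x₀ : ℝ}
    (hs : 0 ≤ s) (hx₀ : 0 < x₀) {k : ℝ≥0} (hk : 0 < k)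
    (h : ∀ x, x₀ ≤ x → k * μ.real (Set.Ici x) ≤ exponentLE μ s x) (Λ : ℝ≥0) :
    ∫⁻ ξ, ENNReal.ofReal (invLaplace s (FinConfig.sinr W ξ)) ∂(poissonProcess μ Λ) ≤
      ENNReal.ofReal (Λ * Real.exp (-(Λ * tailOf μ x₀))) + ENNReal.ofReal (1 / k) := by
  refine (lintegral_invLaplace_le hW hμ hs).trans ?_
  have h1 : ∫⁻ x, ENNReal.ofReal (invLaplace (s * W) x) *
        ENNReal.ofReal (Real.exp (-(Λ * exponentLE μ s x))) ∂μ ≤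
      ∫⁻ x in Set.Ioi 0, ENNReal.ofReal (Real.exp (-(Λ * exponentLE μ s x))) ∂μ := by
    rw [← lintegral_indicator measurableSet_Ioi]
    refine lintegral_mono fun x => ?_
    by_cases hx : 0 < x
    · rw [Set.indicator_of_mem (Set.mem_Ioi.2 hx)]
      exact mul_le_of_le_one_left' (ENNReal.ofReal_le_one.2
        (invLaplace_le_one (mul_nonneg hs hW.le) x))
    · simp [invLaplace, hx]
  refine (mul_le_mul_right h1 _).trans ?_
  rw [← Set.Ioc_union_Ioi_eq_Ioi hx₀.le,
    lintegral_union measurableSet_Ioi (Set.Ioc_disjoint_Ioi le_rfl), mul_add]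
  refine add_le_add (setLIntegral_Ioc_exp_le Λ x₀ fun x hx hxx =>
    (tailOf_antitone μ hxx).trans (tailOf_le_exponentLE hμ hs hx)) ?_
  have h2 : (Λ : ℝ≥0∞) * ∫⁻ x in Set.Ioi x₀, ENNReal.ofReal (Real.exp (-(Λ * exponentLE μ s x))) ∂μ ≤
      Λ * ∫⁻ x in Set.Ioi 0,
        ENNReal.ofReal (Real.exp (-((k * Λ : ℝ≥0) * μ.real (Set.Ici x)))) ∂μ := by
    refine mul_le_mul_right ?_ _
    refine le_trans ?_ (lintegral_mono_set (Set.Ioi_subset_Ioi hx₀.le))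
    refine setLIntegral_mono' measurableSet_Ioi fun x hx => ?_
    refine ENNReal.ofReal_le_ofReal (Real.exp_le_exp.2 (neg_le_neg ?_))
    have := mul_le_mul_of_nonneg_left (h x (le_of_lt hx)) Λ.coe_nonneg
    push_cast
    calc _ = (Λ : ℝ) * (k * μ.real (Set.Ici x)) := by ring
      _ ≤ _ := this
  refine h2.trans ?_
  have h3 := lintegral_tail_le_one (μ := μ) (Λ := k * Λ) hμ
  rw [one_div, ENNReal.ofReal_inv_of_pos (by exact_mod_cast hk), ENNReal.ofReal_coe_nnreal,
    ENNReal.le_inv_iff_mul_le, mul_comm, ← mul_assoc]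
  exact_mod_cast h3

/-- Again a process of mean kΛ at s = 0 is the comparison. ε bounds the loss from the noise beyond
x₀, and the final bracket collects the absence of positive points and the part below x₀. -/
lemma le_lintegral_invLaplace_of_exponent (hW : 0 < W) (hμ : μ (Set.Iio 0) = 0) {s x₀ ε : ℝ}
    (hs : 0 ≤ s) (hx₀ : 0 < x₀) {k : ℝ≥0} (hε : 0 ≤ ε)
    (h : ∀ x, x₀ ≤ x → exponentLT μ s x ≤ k * tailOf μ x)
    (hω : ∀ x, x₀ ≤ x → 1 - ε ≤ Real.exp (-(s * W / x))) (Λ : ℝ≥0) :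
    ENNReal.ofReal (1 - ε) ≤
      k * ∫⁻ ξ, ENNReal.ofReal (invLaplace s (FinConfig.sinr W ξ)) ∂(poissonProcess μ Λ) +
      (ENNReal.ofReal (Real.exp (-((k * Λ : ℝ≥0) * tailOf μ 0))) +
      ENNReal.ofReal ((k * Λ : ℝ≥0) * Real.exp (-((k * Λ : ℝ≥0) * tailOf μ x₀)))) := by
  have h1 := one_le_lintegral_tail (μ := μ) (Λ := k * Λ) hμ
  rw [← Set.Ioc_union_Ioi_eq_Ioi hx₀.le,
    lintegral_union measurableSet_Ioi (Set.Ioc_disjoint_Ioi le_rfl), mul_add] at h1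
  have h2 := setLIntegral_Ioc_exp_le (μ := μ) (k * Λ) x₀ (f := tailOf μ)
    fun x _ hxx => tailOf_antitone μ hxx
  set e := ENNReal.ofReal (Real.exp (-((k * Λ : ℝ≥0) * tailOf μ 0)))
  set J := ∫⁻ x in Set.Ioi x₀, ENNReal.ofReal (Real.exp (-((k * Λ : ℝ≥0) * tailOf μ x))) ∂μ with hJ
  have hL : ENNReal.ofReal (1 - ε) * (Λ * J) ≤
      ∫⁻ ξ, ENNReal.ofReal (invLaplace s (FinConfig.sinr W ξ)) ∂(poissonProcess μ Λ) := by
    refine le_trans ?_ (le_lintegral_invLaplace hW hμ hs)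
    rw [mul_left_comm]
    refine mul_le_mul_right ?_ _
    rw [hJ, ← lintegral_const_mul' _ _ ENNReal.ofReal_ne_top, ← lintegral_indicator measurableSet_Ioi]
    refine lintegral_mono fun x => ?_
    by_cases hx : x₀ < x
    · rw [Set.indicator_of_mem (Set.mem_Ioi.2 hx), invLaplace, if_pos (hx₀.trans hx)]
      refine mul_le_mul' (ENNReal.ofReal_le_ofReal (hω x hx.le))
        (ENNReal.ofReal_le_ofReal (Real.exp_le_exp.2 (neg_le_neg ?_)))
      have := mul_le_mul_of_nonneg_left (h x hx.le) Λ.coe_nonneg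
      push_cast
      calc _ ≤ (Λ : ℝ) * (k * tailOf μ x) := this
        _ = _ := by ring
    · rw [Set.indicator_of_notMem (fun h' => hx (Set.mem_Ioi.1 h'))]
      exact zero_le
  have hε' : ENNReal.ofReal (1 - ε) ≤ 1 := ENNReal.ofReal_le_one.2 (by linarith)
  calc ENNReal.ofReal (1 - ε) = ENNReal.ofReal (1 - ε) * 1 := (mul_one _).symm
    _ ≤ ENNReal.ofReal (1 - ε) * (e + (_ + ((k * Λ : ℝ≥0) : ℝ≥0∞) * J)) := mul_le_mul_right h1 _
    _ ≤ k * (ENNReal.ofReal (1 - ε) * (Λ * J)) + ENNReal.ofReal (1 - ε) * (e + ENNReal.ofReal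
        ((k * Λ : ℝ≥0) * Real.exp (-((k * Λ : ℝ≥0) * tailOf μ x₀)))) := by
      rw [← add_assoc, mul_add, add_comm, ENNReal.coe_mul]
      refine add_le_add (le_of_eq (by ring)) (mul_le_mul_right (add_le_add_right ?_ _) _)
      exact_mod_cast h2
    _ ≤ _ := add_le_add (mul_le_mul_right hL _) (mul_le_of_le_one_left' hε')

lemma tendsto_exp_neg_mul {c : ℝ} (hc : 0 < c) :
    Tendsto (fun Λ : ℝ≥0 => Real.exp (-(Λ * c))) atTop (𝓝 0) :=
  Real.tendsto_exp_neg_atTop_nhds_zero.comp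
    ((NNReal.tendsto_coe_atTop.2 tendsto_id).atTop_mul_const hc)

lemma tendsto_mul_exp_neg_mul {c : ℝ} (hc : 0 < c) :
    Tendsto (fun Λ : ℝ≥0 => Λ * Real.exp (-(Λ * c))) atTop (𝓝 0) := by
  have h1 := (Real.tendsto_pow_mul_exp_neg_atTop_nhds_zero 1).comp
    ((NNReal.tendsto_coe_atTop.2 tendsto_id).atTop_mul_const hc)
  have h2 := h1.const_mul c⁻¹
  rw [mul_zero] at h2
  refine h2.congr fun Λ => ?_
  simp
  field_simp

lemma integrable_invLaplace_sinr {Λ : ℝ≥0} {s : ℝ} (hs : 0 ≤ s) :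
    Integrable (fun ξ => invLaplace s (FinConfig.sinr W ξ)) (poissonProcess μ Λ) := by
  refine Integrable.of_bound ((measurable_invLaplace s).comp
    (FinConfig.measurable_sinr W)).aestronglyMeasurable 1 (ae_of_all _ fun ξ => ?_)
  rw [Real.norm_of_nonneg (invLaplace_nonneg _ _)]
  exact invLaplace_le_one hs _

/-- The Laplace transform of the inverse SINR converges, and the limit depends on `α` only. -/
theorem RegularlyVarying.tendsto_integral_invLaplace {α : ℝ}
    (hF : RegularlyVarying (tailOf μ) (-α)) (hμ : μ (Set.Iio 0) = 0) (hα0 : 0 ≤ α) (hα1 : α < 1)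
    (hW : 0 < W) {s : ℝ} (hs : 0 ≤ s) :
    Tendsto (fun Λ : ℝ≥0 => ∫ ξ, invLaplace s (FinConfig.sinr W ξ) ∂(poissonProcess μ Λ)) atTop
      (𝓝 (1 / limitExponent α s)) := by
  set κ := limitExponent α s with hκ
  have hκ0 : 0 < κ := limitExponent_pos α hs
  have hLE := hF.tendsto_exponentLE hμ hα0 hα1 hs
  have hIci := hF.tendsto_tail_Ici
  have hint : ∀ Λ : ℝ≥0, ENNReal.ofReal
      (∫ ξ, invLaplace s (FinConfig.sinr W ξ) ∂(poissonProcess μ Λ)) =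
      ∫⁻ ξ, ENNReal.ofReal (invLaplace s (FinConfig.sinr W ξ)) ∂(poissonProcess μ Λ) := fun Λ =>
    ofReal_integral_eq_lintegral_ofReal (integrable_invLaplace_sinr hs)
      (ae_of_all _ fun ξ => invLaplace_nonneg _ _)
  have hnn : ∀ Λ : ℝ≥0, 0 ≤ ∫ ξ, invLaplace s (FinConfig.sinr W ξ) ∂(poissonProcess μ Λ) :=
    fun Λ => integral_nonneg fun ξ => invLaplace_nonneg _ _
  refine tendsto_order.2 ⟨fun a ha => ?_, fun a ha => ?_⟩
  · have h1 : Tendsto (fun K => a * K) (𝓝[>] κ) (𝓝 (a * κ)) :=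
      ((continuous_const.mul continuous_id).tendsto κ).mono_left nhdsWithin_le_nhds
    -- K is slightly above κ with aK < 1; the gap 1 - aK is shared between the noise loss ε and the
    -- error terms.
    obtain ⟨K, hK1, hK⟩ := ((h1.eventually_lt_const ((lt_div_iff₀ hκ0).1 ha)).and
      self_mem_nhdsWithin).exists
    have hK : κ < K := hK
    obtain ⟨ε, hε0, hε1⟩ := exists_between (show 0 < min 1 (1 - a * K) by
      rw [lt_min_iff]; constructor <;> linarith)
    have hLT : ∀ᶠ x in atTop, exponentLT μ s x ≤ K * tailOf μ x := by
      have h2 : Tendsto (fun x => exponentLE μ s x / tailOf μ x +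
          (μ.real (Set.Ici x) / tailOf μ x - 1)) atTop (𝓝 κ) := by
        simpa using hLE.add (hIci.sub_const 1)
      filter_upwards [h2.eventually_lt_const hK] with x hx
      have hT := hF.tail_pos x
      refine (exponentLT_le hμ hs).trans ((div_le_iff₀ hT).1 ?_)
      refine le_of_eq_of_le ?_ hx.le
      field_simp
    have hω : ∀ᶠ x : ℝ in atTop, 1 - ε ≤ Real.exp (-(s * W / x)) := by
      have h3 : Tendsto (fun x : ℝ => Real.exp (-(s * W / x))) atTop (𝓝 1) := by
        have : Tendsto (fun x : ℝ => -(s * W / x)) atTop (𝓝 0) := by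
          simpa using (tendsto_id.const_div_atTop (s * W)).neg
        simpa [Function.comp_def] using (Real.continuous_exp.tendsto 0).comp this
      exact (h3.eventually_const_lt (by linarith)).mono fun x hx => hx.le
    obtain ⟨x₀, hx₀⟩ := eventually_atTop.1 ((hLT.and hω).and (eventually_gt_atTop 0))
    have hK0 : 0 < K := hκ0.trans hK
    lift K to ℝ≥0 using hK0.le
    have hKΛ : Tendsto (fun Λ : ℝ≥0 => K * Λ) atTop atTop :=
      tendsto_id.const_mul_atTop (by exact_mod_cast hK0)
    have herr : Tendsto (fun Λ : ℝ≥0 => Real.exp (-((K * Λ : ℝ≥0) * tailOf μ 0)) +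
        (K * Λ : ℝ≥0) * Real.exp (-((K * Λ : ℝ≥0) * tailOf μ x₀))) atTop (𝓝 0) := by
      simpa using ((tendsto_exp_neg_mul (hF.tail_pos 0)).comp hKΛ).add
        ((tendsto_mul_exp_neg_mul (hF.tail_pos x₀)).comp hKΛ)
    have hgap : 0 < 1 - ε - a * K := by linarith [hε1.trans_le (min_le_right _ _)]
    filter_upwards [herr.eventually_lt_const hgap] with Λ hΛ
    have h4 := le_lintegral_invLaplace_of_exponent (k := K) hW hμ hs (hx₀ x₀ le_rfl).2 hε0.le
      (fun x hx => (hx₀ x hx).1.1)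
      (fun x hx => (hx₀ x hx).1.2) Λ
    rw [← hint, ← ENNReal.ofReal_coe_nnreal, ← ENNReal.ofReal_mul K.coe_nonneg,
      ← ENNReal.ofReal_add (by positivity) (by positivity),
      ← ENNReal.ofReal_add (mul_nonneg K.coe_nonneg (hnn Λ)) (by positivity),
      ENNReal.ofReal_le_ofReal_iff (add_nonneg (mul_nonneg K.coe_nonneg (hnn Λ)) (by positivity))] at h4
    refine lt_of_mul_lt_mul_left ?_ K.coe_nonneg
    change (K : ℝ) * a < K * _
    linarith
  · have h1 : Tendsto (fun K => a * K) (𝓝[<] κ) (𝓝 (a * κ)) :=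
      ((continuous_const.mul continuous_id).tendsto κ).mono_left nhdsWithin_le_nhds
    obtain ⟨k, hk1, hk⟩ := ((h1.eventually_const_lt ((div_lt_iff₀ hκ0).1 ha)).and
      (Ioo_mem_nhdsLT hκ0)).exists
    have hk0 : 0 < k := hk.1
    have hev : ∀ᶠ x in atTop, k * μ.real (Set.Ici x) ≤ exponentLE μ s x := by
      have h2 : Tendsto (fun x => k * (μ.real (Set.Ici x) / tailOf μ x)) atTop (𝓝 (k * 1)) :=
        hIci.const_mul k
      filter_upwards [h2.eventually_lt hLE (by rw [mul_one]; exact hk.2)] with x hx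
      have hT := hF.tail_pos x
      rw [← mul_div_assoc, div_lt_div_iff_of_pos_right hT] at hx
      exact hx.le
    obtain ⟨x₀, hx₀⟩ := eventually_atTop.1 (hev.and (eventually_gt_atTop 0))
    lift k to ℝ≥0 using hk0.le
    have hgap : 0 < a - 1 / k := by
      have : 1 / (k : ℝ) < a := (div_lt_iff₀ hk0).2 hk1
      linarith
    filter_upwards [(tendsto_mul_exp_neg_mul (hF.tail_pos x₀)).eventually_lt_const hgap] with Λ hΛ
    have h4 := lintegral_invLaplace_le_of_exponent (k := k) hW hμ hs (hx₀ x₀ le_rfl).2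
      (by exact_mod_cast hk0) (fun x hx => (hx₀ x hx).1) Λ
    rw [← hint, ← ENNReal.ofReal_add (by positivity) (by positivity),
      ENNReal.ofReal_le_ofReal_iff (by positivity)] at h4
    linarith

end LaplaceLimit

/-! ### Convergence of moments on the unit interval -/

lemma tendsto_integral_polynomial {ι : Type*} {l : Filter ι} {ν : ι → Measure ℝ}
    [∀ i, IsProbabilityMeasure (ν i)] (hν : ∀ i, ∀ᵐ x ∂(ν i), x ∈ Set.Icc (0 : ℝ) 1)
    {m : ℕ → ℝ} (hm : ∀ n, Tendsto (fun i => ∫ x, x ^ n ∂(ν i)) l (𝓝 (m n)))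
    (p : Polynomial ℝ) :
    Tendsto (fun i => ∫ x, p.eval x ∂(ν i)) l (𝓝 (∑ n ∈ p.support, p.coeff n * m n)) := by
  have hint : ∀ i (n : ℕ), Integrable (fun x : ℝ => x ^ n) (ν i) := by
    intro i n
    refine Integrable.of_bound (by fun_prop) 1 ?_
    filter_upwards [hν i] with x hx
    rw [Real.norm_of_nonneg (pow_nonneg hx.1 n)]
    exact pow_le_one₀ hx.1 hx.2
  have he : ∀ i, ∫ x, p.eval x ∂(ν i) = ∑ n ∈ p.support, p.coeff n * ∫ x, x ^ n ∂(ν i) := by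
    intro i
    simp_rw [Polynomial.eval_eq_sum, Polynomial.sum]
    rw [integral_finsetSum _ fun n _ => (hint i n).const_mul _]
    simp_rw [integral_const_mul]
  simp_rw [he]
  exact tendsto_finsetSum _ fun n _ => (hm n).const_mul _

lemma abs_integral_sub_polynomial_le {ν : Measure ℝ} [IsProbabilityMeasure ν]
    (hν : ∀ᵐ x ∂ν, x ∈ Set.Icc (0 : ℝ) 1) {f : ℝ → ℝ} (hf : Continuous f) {p : Polynomial ℝ}
    {ε : ℝ} (hp : ∀ x ∈ Set.Icc (0 : ℝ) 1, |p.eval x - f x| < ε) :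
    |∫ x, p.eval x ∂ν - ∫ x, f x ∂ν| ≤ ε := by
  have hint : ∀ g : ℝ → ℝ, Continuous g → Integrable g ν := by
    intro g hg
    obtain ⟨C, hC⟩ := isCompact_Icc.exists_bound_of_continuousOn (hg.continuousOn (s := Set.Icc 0 1))
    exact Integrable.of_bound hg.aestronglyMeasurable C (hν.mono fun x hx => hC x hx)
  rw [← integral_sub (hint _ p.continuous) (hint f hf)]
  have := norm_integral_le_of_norm_le_const (μ := ν) (C := ε)
    (hν.mono fun x hx => by simpa using (hp x hx).le : ∀ᵐ x ∂ν, ‖p.eval x - f x‖ ≤ ε)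
  simpa using this

/-- Two families of laws on `[0, 1]` with the same limits of moments are asymptotically equal. -/
lemma tendsto_integral_sub_integral {ι ι' : Type*} {l : Filter ι} {l' : Filter ι'}
    {ν : ι → Measure ℝ} {ν' : ι' → Measure ℝ} [∀ i, IsProbabilityMeasure (ν i)]
    [∀ i, IsProbabilityMeasure (ν' i)] (hν : ∀ i, ∀ᵐ x ∂(ν i), x ∈ Set.Icc (0 : ℝ) 1)
    (hν' : ∀ i, ∀ᵐ x ∂(ν' i), x ∈ Set.Icc (0 : ℝ) 1) {m : ℕ → ℝ}
    (hm : ∀ n, Tendsto (fun i => ∫ x, x ^ n ∂(ν i)) l (𝓝 (m n)))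
    (hm' : ∀ n, Tendsto (fun i => ∫ x, x ^ n ∂(ν' i)) l' (𝓝 (m n))) {f : ℝ → ℝ}
    (hf : Continuous f) :
    Tendsto (fun q : ι × ι' => ∫ x, f x ∂(ν q.1) - ∫ x, f x ∂(ν' q.2)) (l ×ˢ l') (𝓝 0) := by
  rw [Metric.tendsto_nhds]
  intro ε hε
  -- Weierstrass: one polynomial, uniformly ε/3-close to f on [0,1], serves all laws of both
  -- families at once.
  obtain ⟨p, hp⟩ := exists_polynomial_near_of_continuousOn 0 1 f hf.continuousOn (ε / 3)
    (by positivity)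
  have h : Tendsto (fun q : ι × ι' => ∫ x, p.eval x ∂(ν q.1) - ∫ x, p.eval x ∂(ν' q.2))
      (l ×ˢ l') (𝓝 0) := by
    simpa using ((tendsto_integral_polynomial hν hm p).comp tendsto_fst).sub
      ((tendsto_integral_polynomial hν' hm' p).comp (tendsto_snd (f := l)))
  filter_upwards [Metric.tendsto_nhds.1 h (ε / 3) (by positivity)] with q hq
  rw [Real.dist_eq, sub_zero] at hq ⊢
  have h1 := abs_le.1 (abs_integral_sub_polynomial_le (hν q.1) hf hp)
  have h2 := abs_le.1 (abs_integral_sub_polynomial_le (hν' q.2) hf hp)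
  have h3 := abs_lt.1 hq
  rw [abs_lt]
  constructor <;> linarith [h1.1, h1.2, h2.1, h2.2, h3.1, h3.2]

/-! ### Coverage probability and rate -/

/-- The coverage probability in terms of the law of the received powers. -/
def powerCoverage (μ : Measure ℝ) (W : ℝ) (Λ : ℝ≥0) (y : ℝ) : ℝ :=
  (poissonProcess μ Λ).real {ξ | y ≤ ξ.sinr W}

/-- The average rate in terms of the law of the received powers. -/
def powerRate (μ : Measure ℝ) (W : ℝ) (Λ : ℝ≥0) : ℝ≥0∞ :=
  ∫⁻ ξ, ENNReal.ofReal (Real.log (1 + FinConfig.sinr W ξ)) ∂(poissonProcess μ Λ)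

section Coverage

variable {μ : Measure ℝ} [IsProbabilityMeasure μ] {W : ℝ}

lemma measurableSet_le_sinr (W y : ℝ) : MeasurableSet {ξ : FinConfig | y ≤ ξ.sinr W} :=
  measurableSet_le measurable_const (FinConfig.measurable_sinr W)

lemma measurable_invLaplace_sinr (s W : ℝ) :
    Measurable fun ξ : FinConfig => invLaplace s (ξ.sinr W) :=
  (measurable_invLaplace s).comp (FinConfig.measurable_sinr W)

lemma powerCoverage_nonneg (μ : Measure ℝ) (W : ℝ) (Λ : ℝ≥0) (y : ℝ) :
    0 ≤ powerCoverage μ W Λ y := measureReal_nonneg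

lemma powerCoverage_le_one (Λ : ℝ≥0) (y : ℝ) : powerCoverage μ W Λ y ≤ 1 := measureReal_le_one

lemma powerCoverage_antitone (Λ : ℝ≥0) : Antitone (powerCoverage μ W Λ) :=
  fun _ _ h => measureReal_mono fun _ hξ => h.trans hξ

lemma ofReal_powerCoverage (Λ : ℝ≥0) (y : ℝ) :
    ENNReal.ofReal (powerCoverage μ W Λ y) = poissonProcess μ Λ {ξ | y ≤ ξ.sinr W} :=
  ofReal_measureReal

/-- If the Laplace kernel tends to `1`, the SINR tends to `∞` in probability. -/
lemma tendsto_powerCoverage_one (h : Tendsto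
      (fun Λ : ℝ≥0 => ∫ ξ, invLaplace 1 (FinConfig.sinr W ξ) ∂(poissonProcess μ Λ)) atTop (𝓝 1))
    {y : ℝ} (hy : 0 < y) : Tendsto (fun Λ => powerCoverage μ W Λ y) atTop (𝓝 1) := by
  set q := invLaplace 1 y with hq
  have hq1 : q < 1 := by
    rw [hq, invLaplace, if_pos hy]
    rw [← Real.exp_zero]
    exact Real.exp_lt_exp.2 (neg_lt_zero.2 (by positivity))
  -- The kernel is at most 1 where the SINR reaches y and at most q elsewhere, so its mean is at
  -- most q + (1 - q) times the coverage probability.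
  have hb : ∀ Λ : ℝ≥0, (∫ ξ, invLaplace 1 (FinConfig.sinr W ξ) ∂(poissonProcess μ Λ) - q) / (1 - q) ≤
      powerCoverage μ W Λ y := by
    intro Λ
    rw [div_le_iff₀ (by linarith)]
    have hi : Integrable ({ξ : FinConfig | y ≤ ξ.sinr W}.indicator fun _ => 1 - q)
        (poissonProcess μ Λ) := (integrable_const _).indicator (measurableSet_le_sinr W y)
    have h1 : ∫ ξ, invLaplace 1 (FinConfig.sinr W ξ) ∂(poissonProcess μ Λ) ≤
        ∫ ξ, ({ξ : FinConfig | y ≤ ξ.sinr W}.indicator (fun _ => 1 - q) ξ + q)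
          ∂(poissonProcess μ Λ) := by
      refine integral_mono (integrable_invLaplace_sinr zero_le_one)
        (hi.add (integrable_const _)) fun ξ => ?_
      by_cases hξ : ξ ∈ {ξ : FinConfig | y ≤ ξ.sinr W}
      · simp only [Set.indicator_of_mem hξ, sub_add_cancel]
        exact invLaplace_le_one zero_le_one _
      · simp only [Set.indicator_of_notMem hξ, zero_add]
        exact invLaplace_mono zero_le_one (le_of_lt (not_le.1 hξ))
    rw [integral_add hi (integrable_const _), integral_indicator_const _
      (measurableSet_le_sinr W y)] at h1
    simp only [integral_const, probReal_univ, smul_eq_mul] at h1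
    rw [powerCoverage]
    linarith
  refine tendsto_of_tendsto_of_tendsto_of_le_of_le ?_ tendsto_const_nhds hb
    fun Λ => powerCoverage_le_one Λ y
  have := (h.sub_const q).div_const (1 - q)
  rwa [div_self (by linarith)] at this

lemma ofReal_log_mul_powerCoverage_le (Λ : ℝ≥0) {y : ℝ} (hy : 0 < y) :
    ENNReal.ofReal (Real.log (1 + y)) * ENNReal.ofReal (powerCoverage μ W Λ y) ≤
      powerRate μ W Λ := by
  rw [ofReal_powerCoverage, ← lintegral_indicator_const (measurableSet_le_sinr W y)]
  refine lintegral_mono fun ξ => ?_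
  by_cases hξ : ξ ∈ {ξ : FinConfig | y ≤ ξ.sinr W}
  · rw [Set.indicator_of_mem hξ]
    have hξ : y ≤ ξ.sinr W := hξ
    exact ENNReal.ofReal_le_ofReal (Real.log_le_log (by linarith) (by linarith))
  · rw [Set.indicator_of_notMem hξ]
    exact zero_le

lemma tendsto_powerRate_top (h : ∀ y, 0 < y →
    Tendsto (fun Λ => powerCoverage μ W Λ y) atTop (𝓝 1)) :
    Tendsto (fun Λ => powerRate μ W Λ) atTop (𝓝 ⊤) := by
  rw [ENNReal.tendsto_nhds_top_iff_nnreal]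
  intro x
  -- Chosen so that half of log(1 + y) already exceeds x, since coverage is only used to be above
  -- 1/2.
  set y := Real.exp (2 * (x + 1)) with hy
  have hy0 : 0 < y := Real.exp_pos _
  have hlog : 2 * ((x : ℝ) + 1) ≤ Real.log (1 + y) := by
    rw [Real.le_log_iff_exp_le (by positivity)]
    linarith
  filter_upwards [(h y hy0).eventually_const_lt (show (1 / 2 : ℝ) < 1 by norm_num)] with Λ hΛ
  refine lt_of_lt_of_le ?_ (ofReal_log_mul_powerCoverage_le Λ hy0)
  have hx : (0 : ℝ) ≤ x := x.coe_nonneg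
  rw [← ENNReal.ofReal_mul (by linarith), ← ENNReal.ofReal_coe_nnreal]
  refine (ENNReal.ofReal_lt_ofReal_iff_of_nonneg hx).2 ?_
  nlinarith

lemma powerRate_eq_lintegral (hW : 0 < W) (hμ : μ (Set.Iio 0) = 0) (Λ : ℝ≥0) :
    powerRate μ W Λ =
      ∫⁻ u in Set.Ioi 0, ENNReal.ofReal (powerCoverage μ W Λ (Real.exp u - 1)) := by
  have hQ : ∀ᵐ ξ ∂(poissonProcess μ Λ), 0 ≤ FinConfig.sinr W ξ := by
    filter_upwards [ae_nonneg_poissonProcess hμ] with ξ hξ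
    exact FinConfig.sinr_nonneg hW hξ
  have hm : Measurable fun ξ : FinConfig => Real.log (1 + ξ.sinr W) :=
    Real.measurable_log.comp (measurable_const.add (FinConfig.measurable_sinr W))
  rw [powerRate, lintegral_eq_lintegral_meas_le _ (hQ.mono fun ξ hξ =>
    Real.log_nonneg (by linarith)) hm.aemeasurable]
  refine setLIntegral_congr_fun measurableSet_Ioi fun u _ => ?_
  change poissonProcess μ Λ {ξ | u ≤ Real.log (1 + FinConfig.sinr W ξ)} = _
  rw [ofReal_powerCoverage]
  refine measure_congr ?_
  filter_upwards [hQ] with ξ hξ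
  refine propext ?_
  change u ≤ Real.log (1 + FinConfig.sinr W ξ) ↔ Real.exp u - 1 ≤ FinConfig.sinr W ξ
  rw [Real.le_log_iff_exp_le (by linarith), sub_le_iff_le_add']

/-- Convergence of the coverage probabilities, dominated by a power, implies convergence of the
rate. -/
lemma tendsto_powerRate (hW : 0 < W) (hμ : μ (Set.Iio 0) = 0) {C δ : ℝ} (hδ : 0 < δ)
    (hb : ∀ (Λ : ℝ≥0) (y : ℝ), 2 ≤ y → powerCoverage μ W Λ y ≤ C * (y / 2) ^ (-δ)) {c : ℝ → ℝ}
    (hc : ∀ y, 0 < y → Tendsto (fun Λ => powerCoverage μ W Λ y) atTop (𝓝 (c y))) :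
    Tendsto (fun Λ => powerRate μ W Λ) atTop
      (𝓝 (∫⁻ u in Set.Ioi 0, ENNReal.ofReal (c (Real.exp u - 1)))) ∧
    ∫⁻ u in Set.Ioi 0, ENNReal.ofReal (c (Real.exp u - 1)) ≠ ⊤ := by
  -- For exp(u) ≥ 3 one has (exp(u) - 1)/2 ≥ exp(u)/3 and the power bound applies; for exp(u) < 3
  -- the trivial bound 1 is at most (exp(u)/3) ^ (-δ).
  set D := max C 1 * 3 ^ δ with hD
  have hbound : ∀ (Λ : ℝ≥0) (u : ℝ), 0 < u →
      powerCoverage μ W Λ (Real.exp u - 1) ≤ D * Real.exp (-(δ * u)) := by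
    intro Λ u hu
    have e : ∀ t : ℝ, t * 3 ^ δ * Real.exp (-(δ * u)) = t * (Real.exp u / 3) ^ (-δ) := by
      intro t
      rw [Real.div_rpow (Real.exp_nonneg u) (by norm_num), ← Real.exp_mul,
        Real.rpow_neg (by norm_num : (0 : ℝ) ≤ 3)]
      field_simp
    rw [hD, e]
    have hm1 : (1 : ℝ) ≤ max C 1 := le_max_right _ _
    by_cases h3 : 3 ≤ Real.exp u
    · refine (hb Λ _ (by linarith)).trans ?_
      have h4 : ((Real.exp u - 1) / 2) ^ (-δ) ≤ (Real.exp u / 3) ^ (-δ) :=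
        Real.rpow_le_rpow_of_nonpos (by positivity) (by linarith) (by linarith)
      have h5 : 0 ≤ ((Real.exp u - 1) / 2) ^ (-δ) := Real.rpow_nonneg (by linarith) _
      calc C * ((Real.exp u - 1) / 2) ^ (-δ) ≤ max C 1 * ((Real.exp u - 1) / 2) ^ (-δ) :=
            mul_le_mul_of_nonneg_right (le_max_left _ _) h5
        _ ≤ _ := mul_le_mul_of_nonneg_left h4 (by linarith)
    · refine (powerCoverage_le_one Λ _).trans ?_
      have h4 : 1 ≤ (Real.exp u / 3) ^ (-δ) :=
        Real.one_le_rpow_of_pos_of_le_one_of_nonpos (by positivity) (by linarith) (by linarith)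
      nlinarith
  have hfin : ∫⁻ u in Set.Ioi 0, ENNReal.ofReal (D * Real.exp (-(δ * u))) ≠ ⊤ := by
    have hi : IntegrableOn (fun u => D * Real.exp (-(δ * u))) (Set.Ioi 0) := by
      have := (exp_neg_integrableOn_Ioi 0 hδ).const_mul D
      simpa [neg_mul, IntegrableOn] using this
    exact hi.lintegral_lt_top.ne
  have hexp : ∀ u : ℝ, 0 < u → 0 < Real.exp u - 1 := fun u hu => by
    linarith [Real.add_one_lt_exp hu.ne']
  constructor
  · simp_rw [powerRate_eq_lintegral hW hμ]
    refine tendsto_lintegral_filter_of_dominated_convergence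
      (fun u => ENNReal.ofReal (D * Real.exp (-(δ * u)))) ?_ ?_ hfin ?_
    · refine Eventually.of_forall fun Λ => ENNReal.measurable_ofReal.comp ?_
      exact (powerCoverage_antitone Λ).measurable.comp (by fun_prop)
    · refine Eventually.of_forall fun Λ => ?_
      filter_upwards [ae_restrict_mem measurableSet_Ioi] with u hu
      exact ENNReal.ofReal_le_ofReal (hbound Λ u hu)
    · filter_upwards [ae_restrict_mem measurableSet_Ioi] with u hu
      exact (ENNReal.continuous_ofReal.tendsto _).comp (hc _ (hexp u hu))
  · refine ne_top_of_le_ne_top hfin (setLIntegral_mono' measurableSet_Ioi fun u hu => ?_)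
    exact ENNReal.ofReal_le_ofReal (le_of_tendsto (hc _ (hexp u hu))
      (Eventually.of_forall fun Λ => hbound Λ u hu))

/-- For q > 0 both sides are separated by q/(1 + q). The inequality transfers the positive limit of
the Laplace transform to the rate. -/
lemma invLaplace_one_le_log {q : ℝ} (hq : 0 ≤ q) : invLaplace 1 q ≤ Real.log (1 + q) := by
  unfold invLaplace
  split_ifs with h
  · have h1 := Real.one_sub_inv_le_log_of_pos (show 0 < 1 + q by linarith)
    refine le_trans ?_ h1
    have h2 := Real.add_one_le_exp (1 / q)
    rw [Real.exp_neg]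
    have h3 : 1 - (1 + q)⁻¹ = (1 / q + 1)⁻¹ := by
      field_simp
      ring
    rw [h3]
    exact inv_anti₀ (by positivity) h2
  · exact Real.log_nonneg (by linarith)

lemma ofReal_integral_invLaplace_le_powerRate (hW : 0 < W) (hμ : μ (Set.Iio 0) = 0) (Λ : ℝ≥0) :
    ENNReal.ofReal (∫ ξ, invLaplace 1 (FinConfig.sinr W ξ) ∂(poissonProcess μ Λ)) ≤
      powerRate μ W Λ := by
  rw [ofReal_integral_eq_lintegral_ofReal (integrable_invLaplace_sinr zero_le_one)
    (ae_of_all _ fun ξ => invLaplace_nonneg _ _)]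
  refine lintegral_mono_ae ?_
  filter_upwards [ae_nonneg_poissonProcess hμ] with ξ hξ
  exact ENNReal.ofReal_le_ofReal (invLaplace_one_le_log (FinConfig.sinr_nonneg hW hξ))

lemma le_total_add (hμ : μ (Set.Iio 0) = 0) (Λ : ℝ≥0) :
    ∀ᵐ ξ ∂(poissonProcess μ Λ), W ≤ FinConfig.total ξ + W := by
  filter_upwards [ae_nonneg_poissonProcess hμ] with ξ hξ
  linarith [FinConfig.total_nonneg hξ]

/-! ### Tightness, absence of atoms in the limit, and universality of the coverage limit. -/

namespace RegularlyVarying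

variable {α : ℝ}

/-- The coverage probability is dominated by a power of the threshold. -/
lemma exists_powerCoverage_le (hF : RegularlyVarying (tailOf μ) (-α)) (hμ : μ (Set.Iio 0) = 0)
    (hα : 0 < α) (hW : 0 < W) : ∃ C δ : ℝ, 0 < δ ∧ ∀ (Λ : ℝ≥0) (y : ℝ), 2 ≤ y →
      powerCoverage μ W Λ y ≤ C * (y / 2) ^ (-δ) := by
  obtain ⟨C, hC, hb⟩ := hF.exists_tail_mul_le_large (δ := α / 2) (by positivity) (by linarith) hW
  refine ⟨C, α / 2, by positivity, fun Λ y hy => ?_⟩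
  have hpos : 0 ≤ C * (y / 2) ^ (-(α / 2)) := by positivity
  rw [← ENNReal.ofReal_le_ofReal_iff hpos, ofReal_powerCoverage]
  refine (measure_sinr_mem_le hW hμ (A := Set.Ici y) measurableSet_Ici
    fun x hx => lt_of_lt_of_le (show 0 < y by linarith) hx).trans ?_
  calc Λ * ∫⁻ ξ : FinConfig, μ {x | x / (ξ.total + W) ∈ Set.Ici y} ∂(poissonProcess μ Λ)
      ≤ Λ * ∫⁻ ξ : FinConfig, ENNReal.ofReal (C * (y / 2) ^ (-(α / 2))) *
          μ (Set.Ioi (ξ.total + W)) ∂(poissonProcess μ Λ) := by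
        refine mul_le_mul_right (lintegral_mono_ae ?_) _
        filter_upwards [le_total_add hμ Λ] with ξ hξ
        have hz : 0 < ξ.total + W := hW.trans_le hξ
        rw [← ofReal_tailOf, ← ENNReal.ofReal_mul hpos]
        -- Halving y passes from the closed to the open half-line; y ≥ 2 keeps the ratio at least 1.
        refine le_trans (measure_mono (t := Set.Ioi (y / 2 * (ξ.total + W))) fun x hx => ?_)
          ((ofReal_tailOf μ _).symm.le.trans (ENNReal.ofReal_le_ofReal (hb _ _ hξ (by linarith))))
        have hx : y ≤ x / (ξ.total + W) := hx
        rw [le_div_iff₀ hz] at hx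
        refine Set.mem_Ioi.2 (lt_of_lt_of_le ?_ hx)
        nlinarith
    _ = ENNReal.ofReal (C * (y / 2) ^ (-(α / 2))) *
          (Λ * ∫⁻ ξ : FinConfig, μ (Set.Ioi (ξ.total + W)) ∂(poissonProcess μ Λ)) := by
        rw [lintegral_const_mul' _ _ ENNReal.ofReal_ne_top, mul_left_comm]
    _ ≤ _ := mul_le_of_le_one_right' (lintegral_tail_total_le hW hμ)

/-- The law of the SINR puts asymptotically little mass to the left of a given threshold. -/
lemma exists_powerCoverage_sub_le (hF : RegularlyVarying (tailOf μ) (-α))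
    (hμ : μ (Set.Iio 0) = 0) (hW : 0 < W) {y ε : ℝ} (hy : 0 < y) (hε : 0 < ε) :
    ∃ z₀, 0 < z₀ ∧ z₀ < y ∧ ∀ z, z₀ ≤ z → z < y →
      ∀ᶠ Λ : ℝ≥0 in atTop, powerCoverage μ W Λ z - powerCoverage μ W Λ y < ε := by
  have hcont : Tendsto (fun t : ℝ => t ^ (-α) - y ^ (-α)) (𝓝[<] y) (𝓝 0) := by
    have : ContinuousAt (fun t : ℝ => t ^ (-α)) y := Real.continuousAt_rpow_const y _ (Or.inl hy.ne')
    simpa using (this.tendsto.sub_const (y ^ (-α))).mono_left nhdsWithin_le_nhds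
  -- The limit of (F̄(wx) - F̄(yx)) / F̄(x) is w ^ (-α) - y ^ (-α), made less than ε/2. Taking z₀
  -- strictly above w lets open half-lines cover [z, y).
  obtain ⟨w, hw, hw0, hwy⟩ := ((hcont.eventually_lt_const (half_pos hε)).and
    (Ioo_mem_nhdsLT hy)).exists
  obtain ⟨z₀, hwz₀, hz₀y⟩ := exists_between hwy
  refine ⟨z₀, hw0.trans hwz₀, hz₀y, fun z hz₀z hzy => ?_⟩
  have hwz : w < z := hwz₀.trans_le hz₀z
  have hev : ∀ᶠ x in atTop, tailOf μ (w * x) - tailOf μ (y * x) ≤ ε / 2 * tailOf μ x := by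
    filter_upwards [((hF.2 w hw0).sub (hF.2 y hy)).eventually_lt_const hw] with x hx
    have hT := hF.tail_pos x
    rw [← sub_div, div_lt_iff₀ hT] at hx
    exact hx.le
  obtain ⟨x₀, hx₀⟩ := eventually_atTop.1 hev
  filter_upwards [(tendsto_mul_exp_neg_mul (hF.tail_pos x₀)).eventually_lt_const (half_pos hε)]
    with Λ hΛ
  have hsub : powerCoverage μ W Λ z - powerCoverage μ W Λ y =
      (poissonProcess μ Λ).real {ξ | ξ.sinr W ∈ Set.Ico z y} := by
    have hsub : {ξ : FinConfig | y ≤ ξ.sinr W} ⊆ {ξ : FinConfig | z ≤ ξ.sinr W} :=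
      fun ξ hξ => hzy.le.trans hξ
    rw [powerCoverage, powerCoverage, ← measureReal_sdiff hsub (measurableSet_le_sinr W y)]
    congr 1
    ext ξ
    change z ≤ ξ.sinr W ∧ ¬ y ≤ ξ.sinr W ↔ z ≤ ξ.sinr W ∧ ξ.sinr W < y
    rw [not_le]
  have hS : MeasurableSet {ξ : FinConfig | ξ.total ≤ x₀} :=
    measurableSet_le FinConfig.measurable_total measurable_const
  have hmain : poissonProcess μ Λ {ξ | ξ.sinr W ∈ Set.Ico z y} ≤
      ENNReal.ofReal (ε / 2 + Λ * Real.exp (-(Λ * tailOf μ x₀))) := by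
    refine (measure_sinr_mem_le hW hμ measurableSet_Ico
      fun x hx => (hw0.trans hwz).trans_le hx.1).trans ?_
    -- For a large total the comparison of tails applies; a total below x₀ has exponentially small
    -- probability, which beats the factor Λ.
    calc Λ * ∫⁻ ξ : FinConfig, μ {x | x / (ξ.total + W) ∈ Set.Ico z y} ∂(poissonProcess μ Λ)
        ≤ Λ * ∫⁻ ξ : FinConfig, (ENNReal.ofReal (ε / 2) * μ (Set.Ioi (ξ.total + W)) +
            {ξ : FinConfig | ξ.total ≤ x₀}.indicator (fun _ => 1) ξ) ∂(poissonProcess μ Λ) := by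
          refine mul_le_mul_right (lintegral_mono_ae ?_) _
          filter_upwards [le_total_add hμ Λ] with ξ hξ
          have hz : 0 < ξ.total + W := hW.trans_le hξ
          by_cases hξS : ξ ∈ {ξ : FinConfig | ξ.total ≤ x₀}
          · rw [Set.indicator_of_mem hξS]
            exact prob_le_one.trans le_add_self
          · rw [Set.indicator_of_notMem hξS, add_zero, ← ofReal_tailOf,
              ← ENNReal.ofReal_mul (half_pos hε).le]
            have hlarge : x₀ ≤ ξ.total + W := by
              have : x₀ < ξ.total := not_le.1 hξS
              linarith
            refine le_trans (measure_mono (t := Set.Ioi (w * (ξ.total + W)) \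
              Set.Ioi (y * (ξ.total + W))) fun x hx => ?_) ?_
            · have hx1 : z ≤ x / (ξ.total + W) := hx.1
              have hx2 : x / (ξ.total + W) < y := hx.2
              rw [le_div_iff₀ hz] at hx1
              rw [div_lt_iff₀ hz] at hx2
              refine ⟨Set.mem_Ioi.2 (lt_of_lt_of_le ?_ hx1), fun h => ?_⟩
              · exact mul_lt_mul_of_pos_right hwz hz
              · exact lt_asymm hx2 (Set.mem_Ioi.1 h)
            · rw [← ofReal_measureReal]
              refine ENNReal.ofReal_le_ofReal ?_
              rw [measureReal_sdiff (Set.Ioi_subset_Ioi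
                (mul_le_mul_of_nonneg_right hwy.le hz.le)) measurableSet_Ioi]
              exact hx₀ _ hlarge
      _ = ENNReal.ofReal (ε / 2) *
            (Λ * ∫⁻ ξ : FinConfig, μ (Set.Ioi (ξ.total + W)) ∂(poissonProcess μ Λ)) +
            Λ * poissonProcess μ Λ {ξ | ξ.total ≤ x₀} := by
          rw [lintegral_add_right _ (measurable_const.indicator hS),
            lintegral_indicator_const hS, one_mul, mul_add,
            lintegral_const_mul' _ _ ENNReal.ofReal_ne_top, mul_left_comm]
      _ ≤ ENNReal.ofReal (ε / 2) + ENNReal.ofReal (Λ * Real.exp (-(Λ * tailOf μ x₀))) := by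
          refine add_le_add (mul_le_of_le_one_right' (lintegral_tail_total_le hW hμ)) ?_
          rw [ENNReal.ofReal_mul Λ.coe_nonneg, ENNReal.ofReal_coe_nnreal]
          exact mul_le_mul_right (measure_total_le hμ x₀) _
      _ = _ := (ENNReal.ofReal_add (half_pos hε).le (by positivity)).symm
  rw [hsub]
  have h5 := ENNReal.toReal_mono ENNReal.ofReal_ne_top hmain
  rw [ENNReal.toReal_ofReal (by positivity)] at h5
  exact lt_of_le_of_lt h5 (by linarith)

/-- The law of the Laplace kernel of the inverse SINR. -/
lemma tendsto_moment (hF : RegularlyVarying (tailOf μ) (-α)) (hμ : μ (Set.Iio 0) = 0)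
    (hα0 : 0 ≤ α) (hα1 : α < 1) (hW : 0 < W) (n : ℕ) :
    Tendsto (fun Λ : ℝ≥0 =>
        ∫ x, x ^ n ∂((poissonProcess μ Λ).map fun ξ => invLaplace 1 (ξ.sinr W))) atTop
      (𝓝 (if n = 0 then 1 else 1 / limitExponent α n)) := by
  have hm : Measurable fun ξ : FinConfig => invLaplace 1 (ξ.sinr W) :=
    measurable_invLaplace_sinr 1 W
  have he : ∀ Λ : ℝ≥0, ∫ x, x ^ n ∂((poissonProcess μ Λ).map fun ξ => invLaplace 1 (ξ.sinr W)) =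
      ∫ ξ : FinConfig, invLaplace 1 (ξ.sinr W) ^ n ∂(poissonProcess μ Λ) := fun Λ =>
    integral_map hm.aemeasurable (by fun_prop)
  simp_rw [he]
  by_cases hn : n = 0
  · simp [hn]
  · simp_rw [if_neg hn, ← invLaplace_nat_mul n hn]
    exact hF.tendsto_integral_invLaplace hμ hα0 hα1 hW n.cast_nonneg

/-- The coverage probabilities of two networks with the same index are asymptotically equal. -/
lemma tendsto_powerCoverage_sub (hF : RegularlyVarying (tailOf μ) (-α)) (hμ : μ (Set.Iio 0) = 0)
    (hα0 : 0 ≤ α) (hα1 : α < 1) (hW : 0 < W) {μ' : Measure ℝ} [IsProbabilityMeasure μ'] {W' : ℝ}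
    (hF' : RegularlyVarying (tailOf μ') (-α)) (hμ' : μ' (Set.Iio 0) = 0) (hW' : 0 < W')
    {y : ℝ} (hy : 0 < y) :
    Tendsto (fun q : ℝ≥0 × ℝ≥0 => powerCoverage μ W q.1 y - powerCoverage μ' W' q.2 y)
      (atTop ×ˢ atTop) (𝓝 0) := by
  rw [Metric.tendsto_nhds]
  intro ε hε
  obtain ⟨z₁, hz₁0, hz₁y, hz₁⟩ := hF.exists_powerCoverage_sub_le hμ hW hy (half_pos hε)
  obtain ⟨z₂, hz₂0, hz₂y, hz₂⟩ := hF'.exists_powerCoverage_sub_le hμ' hW' hy (half_pos hε)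
  set z := max z₁ z₂ with hz
  have hzy : z < y := max_lt hz₁y hz₂y
  have hz0 : 0 < z := hz₁0.trans_le (le_max_left _ _)
  set a := invLaplace 1 z with ha
  set b := invLaplace 1 y with hb
  have hab : a < b := by
    rw [ha, hb, invLaplace, invLaplace, if_pos hz0, if_pos hy]
    exact Real.exp_lt_exp.2 (neg_lt_neg (one_div_lt_one_div_of_lt hz0 hzy))
  -- A ramp from 0 at a to 1 at b: composed with the kernel it lies between the indicators of SINR ≥
  -- y and SINR ≥ z, and the mass between z and y is asymptotically below ε/2.
  set f : ℝ → ℝ := fun x => max 0 (min 1 ((x - a) / (b - a))) with hf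
  have hfc : Continuous f := by fun_prop
  have hprob : ∀ (ν : Measure ℝ) [IsProbabilityMeasure ν] (V : ℝ) (Λ : ℝ≥0),
      IsProbabilityMeasure ((poissonProcess ν Λ).map fun ξ => invLaplace 1 (ξ.sinr V)) :=
    fun ν _ V Λ => Measure.isProbabilityMeasure_map
      (measurable_invLaplace_sinr 1 V).aemeasurable
  have hsupp : ∀ (ν : Measure ℝ) [IsProbabilityMeasure ν] (V : ℝ) (Λ : ℝ≥0),
      ∀ᵐ x ∂((poissonProcess ν Λ).map fun ξ => invLaplace 1 (ξ.sinr V)),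
        x ∈ Set.Icc (0 : ℝ) 1 := by
    intro ν _ V Λ
    refine (ae_map_iff (p := fun x => x ∈ Set.Icc (0 : ℝ) 1)
      (measurable_invLaplace_sinr 1 V).aemeasurable measurableSet_Icc).2 (ae_of_all _ fun ξ => ⟨invLaplace_nonneg _ _, invLaplace_le_one zero_le_one _⟩)
  have := hprob μ W
  have := hprob μ' W'
  have hlim := tendsto_integral_sub_integral (hsupp μ W) (hsupp μ' W')
    (fun n => hF.tendsto_moment hμ hα0 hα1 hW n) (fun n => hF'.tendsto_moment hμ' hα0 hα1 hW' n) hfc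
  have hsand : ∀ (ν : Measure ℝ) [IsProbabilityMeasure ν] (V : ℝ) (Λ : ℝ≥0),
      powerCoverage ν V Λ y ≤
        ∫ x, f x ∂((poissonProcess ν Λ).map fun ξ => invLaplace 1 (ξ.sinr V)) ∧
      ∫ x, f x ∂((poissonProcess ν Λ).map fun ξ => invLaplace 1 (ξ.sinr V)) ≤
        powerCoverage ν V Λ z := by
    intro ν _ V Λ
    rw [integral_map (measurable_invLaplace_sinr 1 V).aemeasurable
      hfc.aestronglyMeasurable]
    have hi : Integrable (fun ξ : FinConfig => f (invLaplace 1 (ξ.sinr V))) (poissonProcess ν Λ) := by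
      refine Integrable.of_bound (hfc.measurable.comp
        (measurable_invLaplace_sinr 1 V)).aestronglyMeasurable 1 (ae_of_all _ fun ξ => ?_)
      rw [Real.norm_of_nonneg (le_max_left _ _)]
      exact max_le zero_le_one (min_le_left _ _)
    have hind : ∀ t, powerCoverage ν V Λ t =
        ∫ ξ, {ξ : FinConfig | t ≤ ξ.sinr V}.indicator (fun _ => (1 : ℝ)) ξ
          ∂(poissonProcess ν Λ) := by
      intro t
      rw [integral_indicator_const _ (measurableSet_le_sinr V t)]
      simp [powerCoverage]
    have hii : ∀ t, Integrable ({ξ : FinConfig | t ≤ ξ.sinr V}.indicator fun _ => (1 : ℝ))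
        (poissonProcess ν Λ) := fun t =>
      (integrable_const _).indicator (measurableSet_le_sinr V t)
    rw [hind, hind]
    constructor
    · refine integral_mono (hii y) hi fun ξ => ?_
      by_cases hξ : ξ ∈ {ξ : FinConfig | y ≤ ξ.sinr V}
      · simp only [Set.indicator_of_mem hξ]
        have h1 : b ≤ invLaplace 1 (ξ.sinr V) := invLaplace_mono zero_le_one hξ
        refine le_max_of_le_right (le_min le_rfl ?_)
        rw [one_le_div (by linarith)]
        linarith
      · simp only [Set.indicator_of_notMem hξ]
        exact le_max_left _ _
    · refine integral_mono hi (hii z) fun ξ => ?_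
      by_cases hξ : ξ ∈ {ξ : FinConfig | z ≤ ξ.sinr V}
      · simp only [Set.indicator_of_mem hξ]
        exact max_le zero_le_one (min_le_left _ _)
      · simp only [Set.indicator_of_notMem hξ]
        have h1 : invLaplace 1 (ξ.sinr V) ≤ a :=
          invLaplace_mono zero_le_one (le_of_lt (not_le.1 hξ))
        refine max_le le_rfl (min_le_of_right_le ?_)
        exact div_nonpos_of_nonpos_of_nonneg (by linarith) (by linarith)
  filter_upwards [Metric.tendsto_nhds.1 hlim (ε / 2) (half_pos hε),
    tendsto_fst.eventually (hz₁ z (le_max_left _ _) hzy),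
    tendsto_snd.eventually (hz₂ z (le_max_right _ _) hzy)] with q hq h1 h2
  rw [Real.dist_eq, sub_zero] at hq ⊢
  have h3 := abs_lt.1 hq
  have h4 := hsand μ W q.1
  have h5 := hsand μ' W' q.2
  rw [abs_lt]
  constructor <;> linarith [h3.1, h3.2, h4.1, h4.2, h5.1, h5.2]

/-- The coverage probability converges. -/
lemma exists_tendsto_powerCoverage (hF : RegularlyVarying (tailOf μ) (-α))
    (hμ : μ (Set.Iio 0) = 0) (hα0 : 0 ≤ α) (hα1 : α < 1) (hW : 0 < W) {y : ℝ} (hy : 0 < y) :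
    ∃ c, Tendsto (fun Λ => powerCoverage μ W Λ y) atTop (𝓝 c) := by
  refine cauchy_map_iff_exists_tendsto.1 (cauchy_map_iff'.2 ?_)
  rw [uniformity_eq_comap_nhds_zero ℝ, tendsto_comap_iff]
  -- Comparing the network with itself at two independent values of Λ is the Cauchy criterion.
  have h := hF.tendsto_powerCoverage_sub hμ hα0 hα1 hW hF hμ hW hy
  simpa [Function.comp_def] using h.neg

end RegularlyVarying

end Coverage

/-! ### Powers with finite mean -/

section FiniteMean

/-- Monotonicity in t for t ≥ 1, and for t ≤ 1 concavity of 1 - exp(-tp) in t, which vanishes at 0.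
-/
lemma min_one_mul_le_one_sub_exp {t p : ℝ} (ht : 0 ≤ t) (hp : 0 ≤ p) :
    min 1 t * (1 - Real.exp (-p)) ≤ 1 - Real.exp (-(t * p)) := by
  have h0 : Real.exp (-p) ≤ 1 := Real.exp_le_one_iff.2 (by linarith)
  rcases le_total 1 t with h | h
  · rw [min_eq_left h, one_mul]
    have : Real.exp (-(t * p)) ≤ Real.exp (-p) := Real.exp_le_exp.2 (by nlinarith)
    linarith
  · rw [min_eq_right h]
    have := convexOn_exp.2 (Set.mem_univ (-p)) (Set.mem_univ 0) ht (sub_nonneg.2 h) (by ring)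
    simp only [smul_eq_mul, mul_zero, add_zero, Real.exp_zero, mul_one, mul_neg] at this
    linarith

lemma mul_exp_neg_mul_le {a Λ : ℝ} (ha : 0 < a) : Λ * Real.exp (-(Λ * a)) ≤ a⁻¹ := by
  have h1 := Real.add_one_le_exp (Λ * a)
  rw [Real.exp_neg, ← div_eq_mul_inv, div_le_iff₀ (Real.exp_pos _), ← div_eq_inv_mul,
    le_div_iff₀ ha]
  linarith

variable {μ : Measure ℝ} [IsProbabilityMeasure μ] {W : ℝ}

lemma integrable_exp_neg (hμ : μ (Set.Iio 0) = 0) : Integrable (fun p => Real.exp (-p)) μ := by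
  refine Integrable.of_bound (by fun_prop) 1 ?_
  filter_upwards [ae_nonneg_of_Iio hμ] with p hp
  rw [Real.norm_of_nonneg (Real.exp_nonneg _)]
  exact Real.exp_le_one_iff.2 (by linarith)

lemma integral_one_sub_exp_pos (hμ : μ (Set.Iio 0) = 0) (hμ0 : μ (Set.Ioi 0) ≠ 0) :
    0 < ∫ p, (1 - Real.exp (-p)) ∂μ := by
  have hnn : 0 ≤ᵐ[μ] fun p => 1 - Real.exp (-p) := by
    filter_upwards [ae_nonneg_of_Iio hμ] with p hp
    exact sub_nonneg.2 (Real.exp_le_one_iff.2 (by linarith))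
  rw [integral_pos_iff_support_of_nonneg_ae hnn
    ((integrable_const 1).sub (integrable_exp_neg hμ))]
  refine (pos_iff_ne_zero.2 hμ0).trans_le (measure_mono fun p hp => ?_)
  have hp : 0 < p := hp
  have : Real.exp (-p) < 1 := by
    rw [← Real.exp_zero]
    exact Real.exp_lt_exp.2 (by linarith)
  exact (sub_pos.2 this).ne'

/-- The exponent decays no faster than 1/x, whatever the law; its reciprocal therefore grows at most
linearly, which a finite mean can absorb. -/
lemma min_mul_le_exponentLE (hμ : μ (Set.Iio 0) = 0) {s x : ℝ} (hs : 0 ≤ s) (hx : 0 < x) :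
    (∫ p, (1 - Real.exp (-p)) ∂μ) * min 1 (s / x) ≤ exponentLE μ s x := by
  rw [mul_comm, ← integral_const_mul, exponentLE]
  refine integral_mono_ae (((integrable_const 1).sub (integrable_exp_neg hμ)).const_mul _)
    ((integrable_const 1).sub (integrable_dampLE hμ hs x)) ?_
  filter_upwards [ae_nonneg_of_Iio hμ] with p hp
  refine (min_one_mul_le_one_sub_exp (div_nonneg hs hx.le) hp).trans ?_
  refine sub_le_sub_left ?_ 1
  unfold dampLE
  split_ifs
  · rw [div_mul_eq_mul_div]
  · positivity

/-- The majorant of the coverage probability at threshold `y`. -/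
def meanMajorant (W c Λ y x : ℝ) : ℝ :=
  Λ * (invLaplace (y * W) x * Real.exp (-(Λ * (c * min 1 (y / x)))))

/-- Λ exp(-Λa) ≤ 1/a removes Λ and leaves at most (1 + x/y)/c. The noise factor exp(-yW/x) ≤ x/(yW)
makes the constant term linear in x as well, so that the whole bound decays like 1/y. -/
lemma meanMajorant_le {W c Λ y x : ℝ} (hW : 0 < W) (hc : 0 < c) (hy : 0 < y) (hx : 0 ≤ x) :
    meanMajorant W c Λ y x ≤ (1 / W + 1) / c / y * x := by
  rcases hx.eq_or_lt with h0 | hx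
  · subst h0
    simp [meanMajorant, invLaplace]
  set E := invLaplace (y * W) x with hE
  have hE0 : 0 ≤ E := invLaplace_nonneg _ _
  have hE1 : E ≤ 1 := invLaplace_le_one (by positivity) _
  have hE2 : E ≤ x / (y * W) := by
    rw [hE, invLaplace, if_pos hx, Real.exp_neg, ← inv_div (y * W) x]
    refine inv_anti₀ (by positivity) ?_
    linarith [Real.add_one_le_exp (y * W / x)]
  have hm : 0 < min 1 (y / x) := lt_min one_pos (by positivity)
  have h1 : meanMajorant W c Λ y x ≤ E * (c * min 1 (y / x))⁻¹ := by
    rw [meanMajorant, mul_left_comm]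
    exact mul_le_mul_of_nonneg_left (mul_exp_neg_mul_le (by positivity)) hE0
  have h2 : (min 1 (y / x))⁻¹ ≤ 1 + x / y := by
    rcases min_choice 1 (y / x) with h | h <;> rw [h]
    · rw [inv_one]
      have : 0 < x / y := by positivity
      linarith
    · rw [inv_div]
      linarith
  calc meanMajorant W c Λ y x ≤ E * (c * min 1 (y / x))⁻¹ := h1
    _ = c⁻¹ * (E * (min 1 (y / x))⁻¹) := by rw [mul_inv]; ring
    _ ≤ c⁻¹ * (E * (1 + x / y)) := by gcongr
    _ = c⁻¹ * (E + E * (x / y)) := by ring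
    _ ≤ c⁻¹ * (x / (y * W) + 1 * (x / y)) := by gcongr
    _ = _ := by field_simp

lemma measurable_meanMajorant (W c Λ y : ℝ) : Measurable (meanMajorant W c Λ y) := by
  have := measurable_invLaplace (y * W)
  unfold meanMajorant
  fun_prop

lemma tendsto_meanMajorant {W c y x : ℝ} (hc : 0 < c) (hy : 0 < y) (hx : 0 ≤ x) :
    Tendsto (fun Λ : ℝ≥0 => meanMajorant W c Λ y x) atTop (𝓝 0) := by
  rcases hx.eq_or_lt with h0 | hx
  · subst h0
    simp [meanMajorant, invLaplace]
  have hm : 0 < c * min 1 (y / x) := mul_pos hc (lt_min one_pos (by positivity))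
  have := (tendsto_mul_exp_neg_mul hm).const_mul (invLaplace (y * W) x)
  rw [mul_zero] at this
  refine this.congr fun Λ => ?_
  rw [meanMajorant]
  ring

/-- Chernoff bound with s = y: on SINR ≥ y the kernel exp(-y/SINR) is at least 1/e. -/
lemma powerCoverage_le_lintegral (hW : 0 < W) (hμ : μ (Set.Iio 0) = 0) (Λ : ℝ≥0) {y : ℝ}
    (hy : 0 < y) :
    ENNReal.ofReal (powerCoverage μ W Λ y) ≤ ENNReal.ofReal (Real.exp 1) *
      ∫⁻ x, ENNReal.ofReal (meanMajorant W (∫ p, (1 - Real.exp (-p)) ∂μ) Λ y x) ∂μ := by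
  set c := ∫ p, (1 - Real.exp (-p)) ∂μ with hc
  have h1 : ENNReal.ofReal (powerCoverage μ W Λ y) ≤ ENNReal.ofReal (Real.exp 1) *
      ∫⁻ ξ, ENNReal.ofReal (invLaplace y (FinConfig.sinr W ξ)) ∂(poissonProcess μ Λ) := by
    rw [ofReal_powerCoverage, ← lintegral_indicator_one (measurableSet_le_sinr W y),
      ← lintegral_const_mul' _ _ ENNReal.ofReal_ne_top]
    refine lintegral_mono fun ξ => ?_
    by_cases hξ : ξ ∈ {ξ : FinConfig | y ≤ ξ.sinr W}
    · rw [Set.indicator_of_mem hξ]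
      have hξ : y ≤ ξ.sinr W := hξ
      have hQ : 0 < ξ.sinr W := hy.trans_le hξ
      rw [← ENNReal.ofReal_mul (Real.exp_nonneg _), invLaplace, if_pos hQ, ← Real.exp_add]
      change (1 : ℝ≥0∞) ≤ _
      rw [ENNReal.one_le_ofReal, Real.one_le_exp_iff]
      have := (div_le_one hQ).2 hξ
      linarith
    · rw [Set.indicator_of_notMem hξ]
      exact zero_le
  refine h1.trans (mul_le_mul_right ((lintegral_invLaplace_le hW hμ hy.le).trans ?_) _)
  rw [← lintegral_const_mul' _ _ ENNReal.coe_ne_top]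
  refine lintegral_mono fun x => ?_
  rw [meanMajorant, ENNReal.ofReal_mul Λ.coe_nonneg, ENNReal.ofReal_coe_nnreal,
    ENNReal.ofReal_mul (invLaplace_nonneg _ _)]
  refine mul_le_mul_right ?_ _
  by_cases hx : 0 < x
  · refine mul_le_mul_right (ENNReal.ofReal_le_ofReal (Real.exp_le_exp.2 (neg_le_neg ?_))) _
    exact mul_le_mul_of_nonneg_left (min_mul_le_exponentLE hμ hy.le hx) Λ.coe_nonneg
  · simp [invLaplace, hx]

lemma exists_powerCoverage_le_of_integrable (hW : 0 < W) (hμ : μ (Set.Iio 0) = 0)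
    (hμ0 : μ (Set.Ioi 0) ≠ 0) (hint : Integrable (fun x => x) μ) :
    ∃ C : ℝ, ∀ (Λ : ℝ≥0) (y : ℝ), 2 ≤ y → powerCoverage μ W Λ y ≤ C * (y / 2) ^ (-1 : ℝ) := by
  have hc := integral_one_sub_exp_pos hμ hμ0
  set c := ∫ p, (1 - Real.exp (-p)) ∂μ with hc'
  set m := ∫ x, x ∂μ with hm
  have hm0 : 0 ≤ m := integral_nonneg_of_ae (ae_nonneg_of_Iio hμ)
  refine ⟨Real.exp 1 * ((1 / W + 1) / c / 2 * m), fun Λ y hy => ?_⟩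
  have hy0 : 0 < y := by linarith
  have hle : ENNReal.ofReal (powerCoverage μ W Λ y) ≤
      ENNReal.ofReal (Real.exp 1 * ((1 / W + 1) / c / y * m)) := by
    refine (powerCoverage_le_lintegral hW hμ Λ hy0).trans ?_
    rw [ENNReal.ofReal_mul (Real.exp_nonneg 1), hm, ← integral_const_mul,
      ofReal_integral_eq_lintegral_ofReal (hint.const_mul _)
        ((ae_nonneg_of_Iio hμ).mono fun x hx => mul_nonneg (by positivity) hx)]
    refine mul_le_mul_right (lintegral_mono_ae ?_) _
    filter_upwards [ae_nonneg_of_Iio hμ] with x hx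
    exact ENNReal.ofReal_le_ofReal (meanMajorant_le hW hc hy0 hx)
  rw [ENNReal.ofReal_le_ofReal_iff (by positivity)] at hle
  refine hle.trans (le_of_eq ?_)
  rw [Real.rpow_neg_one]
  field_simp

lemma tendsto_powerCoverage_zero (hW : 0 < W) (hμ : μ (Set.Iio 0) = 0)
    (hμ0 : μ (Set.Ioi 0) ≠ 0) (hint : Integrable (fun x => x) μ) {y : ℝ} (hy : 0 < y) :
    Tendsto (fun Λ => powerCoverage μ W Λ y) atTop (𝓝 0) := by
  have hc := integral_one_sub_exp_pos hμ hμ0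
  set c := ∫ p, (1 - Real.exp (-p)) ∂μ with hc'
  have h1 : Tendsto (fun Λ : ℝ≥0 => ∫⁻ x, ENNReal.ofReal (meanMajorant W c Λ y x) ∂μ) atTop
      (𝓝 (∫⁻ _, 0 ∂μ)) := by
    refine tendsto_lintegral_filter_of_dominated_convergence
      (fun x => ENNReal.ofReal ((1 / W + 1) / c / y * x)) ?_ ?_
      ((hint.const_mul _).lintegral_lt_top.ne) ?_
    · exact Eventually.of_forall fun Λ =>
        ENNReal.measurable_ofReal.comp (measurable_meanMajorant W c Λ y)
    · refine Eventually.of_forall fun Λ => ?_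
      filter_upwards [ae_nonneg_of_Iio hμ] with x hx
      exact ENNReal.ofReal_le_ofReal (meanMajorant_le hW hc hy hx)
    · filter_upwards [ae_nonneg_of_Iio hμ] with x hx
      rw [← ENNReal.ofReal_zero]
      exact (ENNReal.continuous_ofReal.tendsto 0).comp (tendsto_meanMajorant hc hy hx)
  have h2 : Tendsto (fun Λ : ℝ≥0 => ENNReal.ofReal (Real.exp 1) *
      ∫⁻ x, ENNReal.ofReal (meanMajorant W c Λ y x) ∂μ) atTop (𝓝 0) := by
    simpa using ENNReal.Tendsto.const_mul h1 (Or.inr ENNReal.ofReal_ne_top)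
  have h3 : Tendsto (fun Λ : ℝ≥0 => ENNReal.ofReal (powerCoverage μ W Λ y)) atTop (𝓝 0) :=
    tendsto_of_tendsto_of_tendsto_of_le_of_le tendsto_const_nhds h2 (fun _ => zero_le)
      fun Λ => powerCoverage_le_lintegral hW hμ Λ hy
  have h4 := (ENNReal.tendsto_toReal ENNReal.zero_ne_top).comp h3
  refine h4.congr fun Λ => ?_
  exact ENNReal.toReal_ofReal (powerCoverage_nonneg μ W Λ y)

lemma tendsto_powerRate_zero (hW : 0 < W) (hμ : μ (Set.Iio 0) = 0)
    (hμ0 : μ (Set.Ioi 0) ≠ 0) (hint : Integrable (fun x => x) μ) :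
    Tendsto (fun Λ => powerRate μ W Λ) atTop (𝓝 0) := by
  obtain ⟨C, hC⟩ := exists_powerCoverage_le_of_integrable hW hμ hμ0 hint
  have := (tendsto_powerRate hW hμ one_pos hC (c := fun _ => 0)
    fun y hy => tendsto_powerCoverage_zero hW hμ hμ0 hint hy).1
  simpa using this

lemma integrable_of_tail_le (hμ : μ (Set.Iio 0) = 0) {C x₀ δ : ℝ} (hx₀ : 0 < x₀) (hδ : 1 < δ)
    (h : ∀ x, x₀ ≤ x → tailOf μ x ≤ C * x ^ (-δ)) : Integrable (fun x => x) μ := by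
  refine ⟨measurable_id.aestronglyMeasurable, ?_⟩
  rw [hasFiniteIntegral_iff_ofReal (ae_nonneg_of_Iio hμ),
    lintegral_eq_lintegral_meas_lt μ (ae_nonneg_of_Iio hμ) aemeasurable_id,
    ← Set.Ioc_union_Ioi_eq_Ioi hx₀.le,
    lintegral_union measurableSet_Ioi (Set.Ioc_disjoint_Ioi le_rfl)]
  refine ENNReal.add_lt_top.2 ⟨?_, ?_⟩
  · refine (lintegral_mono fun t => (prob_le_one : _ ≤ (1 : ℝ≥0∞))).trans_lt ?_
    simp
  · have hi : IntegrableOn (fun x : ℝ => C * x ^ (-δ)) (Set.Ioi x₀) :=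
      (integrableOn_Ioi_rpow_of_lt (by linarith) hx₀).const_mul C
    refine (setLIntegral_mono' measurableSet_Ioi fun t ht => ?_).trans_lt hi.lintegral_lt_top
    change μ (Set.Ioi t) ≤ _
    rw [← ofReal_tailOf]
    exact ENNReal.ofReal_le_ofReal (h t (le_of_lt ht))

lemma exists_le_rpow_of_two_mul_le {h : ℝ → ℝ} (hh : Antitone h) (h0 : ∀ x, 0 ≤ h x) {δ : ℝ}
    (hδ : 0 ≤ δ) (h2 : ∃ x₀ : ℝ, 0 < x₀ ∧ ∀ x, x₀ ≤ x → h (2 * x) ≤ 2 ^ (-δ) * h x) :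
    ∃ C x₀ : ℝ, 0 < x₀ ∧ ∀ x, x₀ ≤ x → h x ≤ C * x ^ (-δ) := by
  obtain ⟨x₀, hx₀, h2⟩ := h2
  refine ⟨(2 * x₀) ^ δ * h x₀, x₀, hx₀, fun x hx => ?_⟩
  have h3 := hh.potter_upper h0 hδ hx₀ h2 le_rfl ((one_le_div hx₀).2 hx)
  rw [div_mul_cancel₀ _ hx₀.ne'] at h3
  refine h3.trans (le_of_eq ?_)
  have hx0 : 0 < x := hx₀.trans_le hx
  rw [div_div, mul_comm x₀ 2, Real.div_rpow hx0.le (by positivity),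
    Real.rpow_neg (by positivity : (0 : ℝ) ≤ 2 * x₀), div_inv_eq_mul]
  ring

lemma RapidlyVarying.exists_two_mul_le {h : ℝ → ℝ} (hF : RapidlyVarying h) (δ : ℝ) :
    ∃ x₀ : ℝ, 0 < x₀ ∧ ∀ x, x₀ ≤ x → h (2 * x) ≤ 2 ^ (-δ) * h x := by
  have h1 : (0 : ℝ) < 2 ^ (-δ) := by positivity
  obtain ⟨x₀, hx₀⟩ := eventually_atTop.1 ((hF.2.1 2 (by norm_num)).eventually_lt_const h1)
  refine ⟨max x₀ 1, by positivity, fun x hx => ?_⟩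
  have h2 := hx₀ x ((le_max_left _ _).trans hx)
  rw [div_lt_iff₀ (hF.1.1 x (by linarith [le_max_right x₀ 1]))] at h2
  exact h2.le

/-- A classified tail whose index is not in `[0, 1]` has a finite mean. -/
lemma ClassifiedTail.integrable (h : ClassifiedTail (tailOf μ)) (hμ : μ (Set.Iio 0) = 0)
    (hα : ∀ α : ℝ, 0 ≤ α → α ≤ 1 → ¬ RegularlyVarying (tailOf μ) (-α)) :
    Integrable (fun x => x) μ := by
  rcases h with ⟨α, hα0, hF⟩ | hF | ⟨H, hH, hF, ho⟩
  · have h1 : 1 < α := by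
      by_contra hc
      exact hα α hα0 (not_lt.1 hc) hF
    -- The exponent (1 + α)/2 lies strictly between 1 and α: below the index for the Potter bound,
    -- above 1 for integrability.
    obtain ⟨C, x₀, hx₀, hb⟩ := exists_le_rpow_of_two_mul_le (tailOf_antitone μ) (tailOf_nonneg μ)
      (δ := (1 + α) / 2) (by linarith) (hF.exists_two_mul_le (by linarith))
    exact integrable_of_tail_le hμ hx₀ (by linarith) hb
  · obtain ⟨C, x₀, hx₀, hb⟩ := exists_le_rpow_of_two_mul_le (tailOf_antitone μ) (tailOf_nonneg μ)
      zero_le_two (hF.exists_two_mul_le 2)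
    exact integrable_of_tail_le hμ hx₀ one_lt_two hb
  · obtain ⟨C, x₀, hx₀, hb⟩ := exists_le_rpow_of_two_mul_le (tailOf_antitone H) (tailOf_nonneg H)
      zero_le_two (hF.exists_two_mul_le 2)
    obtain ⟨x₁, hx₁⟩ := eventually_atTop.1 (ho.bound one_pos)
    refine integrable_of_tail_le hμ (x₀ := max x₀ x₁) (lt_max_of_lt_left hx₀) one_lt_two
      (C := C) fun x hx => ?_
    refine le_trans ?_ (hb x ((le_max_left _ _).trans hx))
    have := hx₁ x ((le_max_right _ _).trans hx)
    rwa [Real.norm_of_nonneg (tailOf_nonneg μ x), Real.norm_of_nonneg (tailOf_nonneg H x),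
      one_mul] at this

end FiniteMean

/-! ### Reduction of the network to the law of the received powers -/

namespace WirelessNetwork

variable {d : ℕ} (net : WirelessNetwork d)

lemma measurable_pathloss : Measurable net.pathloss := by
  unfold pathloss
  refine Finset.measurable_sum _ fun k _ => Measurable.indicator ?_ measurableSet_Ico
  fun_prop

lemma measurable_power : Measurable net.power := by
  have := net.measurable_pathloss
  unfold power
  fun_prop

/-- The law of the power received from a random node. -/
def powerLaw : Measure ℝ := net.nodeLaw.map net.power

instance isProbabilityMeasure_powerLaw : IsProbabilityMeasure net.powerLaw :=
  Measure.isProbabilityMeasure_map net.measurable_power.aemeasurable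

lemma powerTail_eq : net.powerTail = tailOf net.powerLaw := by
  ext t
  rw [tailOf, powerLaw, map_measureReal_apply net.measurable_power measurableSet_Ioi]
  rfl

lemma pathloss_term_nonneg {r : ℝ} (hr : 0 ≤ r) {k : ℕ} (hk : k < net.K) :
    0 ≤ (Set.Ico (net.R k) (net.R (k + 1))).indicator (fun s => net.A k * s ^ net.β k) r := by
  by_cases h : r ∈ Set.Ico (net.R k) (net.R (k + 1))
  · rw [Set.indicator_of_mem h]
    exact mul_nonneg (net.A_pos k hk).le (Real.rpow_nonneg hr _)
  · rw [Set.indicator_of_notMem h]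

lemma pathloss_nonneg {r : ℝ} (hr : 0 ≤ r) : 0 ≤ net.pathloss r :=
  Finset.sum_nonneg fun _ hk => net.pathloss_term_nonneg hr (Finset.mem_range.1 hk)

lemma pathloss_pos {r : ℝ} (hr : 0 < r) (hr' : r < net.radius) : 0 < net.pathloss r := by
  have hex : ∃ n, r < net.R n := ⟨net.K, hr'⟩
  classical
  -- The slope active at r is the one that ends at the first breakpoint beyond r.
  obtain ⟨k, hk⟩ : ∃ k, Nat.find hex = k + 1 := by
    refine Nat.exists_eq_succ_of_ne_zero fun h0 => ?_
    have := Nat.find_spec hex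
    rw [h0, net.R_zero] at this
    exact lt_asymm hr this
  have h1 : r < net.R (k + 1) := hk ▸ Nat.find_spec hex
  have h2 : net.R k ≤ r := not_lt.1 (Nat.find_min hex (m := k) (by omega))
  have hkK : k < net.K := by
    have := Nat.find_min' hex hr'
    omega
  refine Finset.sum_pos' (fun _ hk => net.pathloss_term_nonneg hr.le (Finset.mem_range.1 hk))
    ⟨k, Finset.mem_range.2 hkK, ?_⟩
  rw [Set.indicator_of_mem (Set.mem_Ico.2 ⟨h2, h1⟩)]
  exact mul_pos (net.A_pos k hkK) (Real.rpow_pos_of_pos hr _)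

lemma powerLaw_Iio : net.powerLaw (Set.Iio 0) = 0 := by
  have := net.channelLaw_prob
  rw [powerLaw, Measure.map_apply net.measurable_power measurableSet_Iio]
  refine measure_mono_null (t := Set.univ ×ˢ Set.Iio 0) (fun p hp => ?_) ?_
  · refine ⟨Set.mem_univ _, ?_⟩
    by_contra hc
    have hp : net.power p < 0 := hp
    exact not_le.2 hp (div_nonneg (not_lt.1 hc) (net.pathloss_nonneg (norm_nonneg _)))
  · rw [nodeLaw, Measure.prod_prod, net.channelLaw_nonneg, mul_zero]

lemma volume_domain_ne_zero :
    (volume : Measure (EuclideanSpace ℝ (Fin d))) net.domain ≠ 0 :=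
  (Metric.measure_ball_pos volume 0 net.radius_pos).ne'

lemma powerLaw_Ioi : net.powerLaw (Set.Ioi 0) ≠ 0 := by
  have := net.channelLaw_prob
  have : Nonempty (Fin d) := ⟨⟨0, net.dim_pos⟩⟩
  have hfin : (volume : Measure (EuclideanSpace ℝ (Fin d))) net.domain ≠ ⊤ :=
    measure_ball_lt_top.ne
  rw [powerLaw, Measure.map_apply net.measurable_power measurableSet_Ioi]
  refine fun h0 => ?_
  -- The origin is removed because the pathloss may vanish there; in positive dimension it is a null
  -- set.
  have hsub : (net.domain \ {0}) ×ˢ Set.Ioi 0 ⊆ net.power ⁻¹' Set.Ioi 0 := by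
    rintro ⟨x, m⟩ ⟨⟨hx, hx0⟩, hm⟩
    refine div_pos hm (net.pathloss_pos (norm_pos_iff.2 hx0) ?_)
    simpa [domain] using hx
  have h1 := measure_mono_null hsub h0
  rw [nodeLaw, Measure.prod_prod, mul_eq_zero] at h1
  refine h1.elim (fun h2 => ?_) net.channelLaw_ne_zero
  have hdm : MeasurableSet net.domain := measurableSet_ball
  rw [cond_apply hdm, mul_eq_zero] at h2
  refine h2.elim (fun h3 => hfin (ENNReal.inv_eq_zero.1 h3)) fun h3 => ?_
  rw [Set.inter_eq_right.2 Set.sdiff_subset, measure_sdiff_null (measure_singleton 0)] at h3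
  exact net.volume_domain_ne_zero h3

lemma measurable_powers (n : ℕ) :
    Measurable fun (η : ℕ → EuclideanSpace ℝ (Fin d) × ℝ) (i : Fin n) => net.power (η i) :=
  measurable_pi_iff.2 fun i => net.measurable_power.comp (measurable_pi_apply (i : ℕ))

/-- The configuration of the received powers. -/
def powerConfig (ω : Config d) : FinConfig := ⟨ω.1, fun i => net.power (ω.2 i)⟩

lemma measurable_powerConfig : Measurable net.powerConfig := by
  refine measurable_from_prod_countable_right fun n => ?_
  exact (measurable_finConfig_mk n).comp (net.measurable_powers n)

lemma map_infinitePi_power (n : ℕ) :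
    (Measure.infinitePi fun _ : ℕ => net.nodeLaw).map (fun η (i : Fin n) => net.power (η i)) =
      Measure.pi fun _ => net.powerLaw := by
  refine (Measure.pi_eq fun s hs => ?_).symm
  rw [Measure.map_apply (net.measurable_powers n) (MeasurableSet.univ_pi hs)]
  set t : ℕ → Set (EuclideanSpace ℝ (Fin d) × ℝ) := fun j =>
    if h : j < n then net.power ⁻¹' s ⟨j, h⟩ else Set.univ with ht
  have htm : ∀ j ∈ Finset.range n, MeasurableSet (t j) := by
    intro j hj
    rw [ht]
    simp only [Finset.mem_range.1 hj, dif_pos]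
    exact net.measurable_power (hs _)
  have he : (fun (η : ℕ → EuclideanSpace ℝ (Fin d) × ℝ) (i : Fin n) => net.power (η i)) ⁻¹'
      Set.univ.pi s = (Finset.range n : Set ℕ).pi t := by
    ext η
    constructor
    · intro h j hj
      have hj' : j < n := by simpa using hj
      have := h ⟨j, hj'⟩ (Set.mem_univ _)
      simpa [ht, hj'] using this
    · intro h i _
      have := h i (by simp)
      simpa [ht] using this
  rw [he, Measure.infinitePi_pi _ htm, Finset.prod_range]
  refine Finset.prod_congr rfl fun i _ => ?_
  rw [powerLaw, Measure.map_apply net.measurable_power (hs i)]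
  simp [ht]

/-- The mean number of nodes. -/
def meanNumber (lam : ℝ) : ℝ≥0 :=
  (lam * (volume : Measure (EuclideanSpace ℝ (Fin d))).real net.domain).toNNReal

/-- Given the number n of nodes, the first n entries of the sequence yield n independent powers of
law `powerLaw`. Coverage and rate thus become those of the process on the line. -/
lemma map_poissonLaw (lam : ℝ) :
    (net.poissonLaw lam).map net.powerConfig =
      poissonProcess net.powerLaw (net.meanNumber lam) := by
  ext s hs
  rw [Measure.map_apply net.measurable_powerConfig hs, poissonLaw,
    Measure.prod_apply (net.measurable_powerConfig hs), lintegral_countable', poissonProcess,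
    Measure.sum_apply _ hs]
  refine tsum_congr fun n => ?_
  rw [Measure.smul_apply, smul_eq_mul, mul_comm, ← net.map_infinitePi_power n,
    Measure.map_apply (measurable_finConfig_mk n) hs, Measure.map_apply
      (net.measurable_powers n) (measurable_finConfig_mk n hs)]
  rfl

lemma sinr_powerConfig (ω : Config d) : (net.powerConfig ω).sinr net.W = net.sinr ω := by
  unfold FinConfig.sinr sinr
  refine iSup_congr fun i => ?_
  unfold quality interference FinConfig.rest
  have : (Finset.range ω.1).erase i = (Finset.univ.erase i).map Fin.valEmbedding := by
    ext j
    simp only [Finset.mem_erase, Finset.mem_range, Finset.mem_map, Finset.mem_univ, and_true,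
      Fin.valEmbedding_apply]
    constructor
    · rintro ⟨h1, h2⟩
      exact ⟨⟨j, h2⟩, fun h => h1 (by rw [← h]), rfl⟩
    · rintro ⟨k, hk, rfl⟩
      exact ⟨fun h => hk (Fin.ext h), k.2⟩
  rw [this, Finset.sum_map]
  rfl

lemma coverage_eq (y lam : ℝ) :
    net.coverage y lam = powerCoverage net.powerLaw net.W (net.meanNumber lam) y := by
  rw [coverage, powerCoverage, ← map_poissonLaw, map_measureReal_apply net.measurable_powerConfig
    (measurableSet_le_sinr _ _)]
  congr 1
  ext ω
  change y ≤ net.sinr ω ↔ y ≤ (net.powerConfig ω).sinr net.W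
  rw [sinr_powerConfig]

lemma rate_eq (lam : ℝ) : net.rate lam = powerRate net.powerLaw net.W (net.meanNumber lam) := by
  have hm : Measurable fun ξ : FinConfig => ENNReal.ofReal (Real.log (1 + ξ.sinr net.W)) :=
    ENNReal.measurable_ofReal.comp
      (Real.measurable_log.comp (measurable_const.add (FinConfig.measurable_sinr net.W)))
  rw [powerRate, ← map_poissonLaw, lintegral_map hm net.measurable_powerConfig]
  simp_rw [sinr_powerConfig]
  rfl

lemma tendsto_meanNumber : Tendsto net.meanNumber atTop atTop := by
  refine tendsto_real_toNNReal_atTop.comp (tendsto_id.atTop_mul_const ?_)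
  exact ENNReal.toReal_pos net.volume_domain_ne_zero measure_ball_lt_top.ne

lemma tendsto_coverageDensity {y c : ℝ}
    (h : Tendsto (fun Λ => powerCoverage net.powerLaw net.W Λ y) atTop (𝓝 c)) :
    Tendsto (fun lam : ℝ => net.coverageDensity y lam / lam) atTop (𝓝 c) := by
  refine (h.comp net.tendsto_meanNumber).congr' ?_
  filter_upwards [eventually_gt_atTop 0] with lam hlam
  rw [coverageDensity, mul_div_cancel_left₀ _ hlam.ne', coverage_eq]
  rfl

lemma tendsto_areaSpectralEfficiency {c : ℝ≥0∞}
    (h : Tendsto (fun Λ => powerRate net.powerLaw net.W Λ) atTop (𝓝 c)) :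
    Tendsto (fun lam : ℝ => net.areaSpectralEfficiency lam / ENNReal.ofReal lam) atTop (𝓝 c) := by
  refine (h.comp net.tendsto_meanNumber).congr' ?_
  filter_upwards [eventually_gt_atTop 0] with lam hlam
  rw [areaSpectralEfficiency, mul_comm, ENNReal.mul_div_cancel_right
    (ENNReal.ofReal_pos.2 hlam).ne' ENNReal.ofReal_ne_top, rate_eq]
  rfl

/-- For each index, the limits of the coverage probability and of the rate do not depend on the
network. -/
lemma exists_limits {α : ℝ} (hα0 : 0 < α) (hα1 : α < 1) :
    ∃ (c : ℝ → ℝ) (c' : ℝ), (∀ y, 0 < y → 0 ≤ c y ∧ c y ≤ 1) ∧ 0 < c' ∧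
      ∀ (d : ℕ) (net : WirelessNetwork d), RegularlyVarying net.powerTail (-α) →
        (∀ y, 0 < y → Tendsto (fun Λ => powerCoverage net.powerLaw net.W Λ y) atTop (𝓝 (c y))) ∧
        Tendsto (fun Λ => powerRate net.powerLaw net.W Λ) atTop (𝓝 (ENNReal.ofReal c')) := by
  by_cases hex : ∃ (d : ℕ) (net : WirelessNetwork d), RegularlyVarying net.powerTail (-α)
  swap
  · push Not at hex
    -- If no network has this index, any admissible constants do; otherwise one reference network
    -- defines them.
    exact ⟨fun _ => 0, 1, fun _ _ => ⟨le_rfl, zero_le_one⟩, one_pos,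
      fun d net h => absurd h (hex d net)⟩
  obtain ⟨d₀, net₀, hF₀⟩ := hex
  rw [powerTail_eq] at hF₀
  have hlim : ∀ y : ℝ, ∃ c, 0 < y →
      Tendsto (fun Λ => powerCoverage net₀.powerLaw net₀.W Λ y) atTop (𝓝 c) := by
    intro y
    by_cases hy : 0 < y
    · obtain ⟨c, hc⟩ :=
        hF₀.exists_tendsto_powerCoverage net₀.powerLaw_Iio hα0.le hα1 net₀.W_pos hy
      exact ⟨c, fun _ => hc⟩
    · exact ⟨0, fun h => absurd h hy⟩
  choose c hc using hlim
  have hcov : ∀ (d : ℕ) (net : WirelessNetwork d), RegularlyVarying (tailOf net.powerLaw) (-α) →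
      ∀ y, 0 < y → Tendsto (fun Λ => powerCoverage net.powerLaw net.W Λ y) atTop (𝓝 (c y)) := by
    intro d net hF y hy
    -- The comparison with the reference network is needed only on the diagonal, with equal mean
    -- numbers of nodes.
    have h := (hF.tendsto_powerCoverage_sub net.powerLaw_Iio hα0.le hα1 net.W_pos hF₀
      net₀.powerLaw_Iio net₀.W_pos hy).comp (tendsto_id.prodMk tendsto_id)
    simpa using h.add (hc y hy)
  set I := ∫⁻ u in Set.Ioi 0, ENNReal.ofReal (c (Real.exp u - 1)) with hI
  have hrate : ∀ (d : ℕ) (net : WirelessNetwork d), RegularlyVarying (tailOf net.powerLaw) (-α) →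
      Tendsto (fun Λ => powerRate net.powerLaw net.W Λ) atTop (𝓝 I) ∧ I ≠ ⊤ := by
    intro d net hF
    obtain ⟨C, δ, hδ, hb⟩ := hF.exists_powerCoverage_le net.powerLaw_Iio hα0 net.W_pos
    exact tendsto_powerRate net.W_pos net.powerLaw_Iio hδ hb (hcov d net hF)
  have hfin : I ≠ ⊤ := (hrate d₀ net₀ hF₀).2
  have hpos : 0 < I := by
    refine lt_of_lt_of_le ?_ (le_of_tendsto_of_tendsto'
      ((ENNReal.continuous_ofReal.tendsto _).comp (hF₀.tendsto_integral_invLaplace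
        net₀.powerLaw_Iio hα0.le hα1 net₀.W_pos zero_le_one)) (hrate d₀ net₀ hF₀).1
      fun Λ => ofReal_integral_invLaplace_le_powerRate net₀.W_pos net₀.powerLaw_Iio Λ)
    exact ENNReal.ofReal_pos.2 (one_div_pos.2 (limitExponent_pos α zero_le_one))
  refine ⟨c, I.toReal, fun y hy => ⟨?_, ?_⟩, ENNReal.toReal_pos hpos.ne' hfin, fun d net hF => ?_⟩
  · exact ge_of_tendsto' (hc y hy) fun Λ => powerCoverage_nonneg _ _ _ _
  · exact le_of_tendsto' (hc y hy) fun Λ => powerCoverage_le_one _ _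
  · rw [powerTail_eq] at hF
    rw [ENNReal.ofReal_toReal hfin]
    exact ⟨hcov d net hF, (hrate d net hF).1⟩

end WirelessNetwork

end

/-! ### The three regimes. -/

theorem corollary2 :
    ∃ (c : ℝ → ℝ → ℝ) (c' : ℝ → ℝ),
      (∀ y α : ℝ, 0 < y → 0 < α → α < 1 → 0 ≤ c y α ∧ c y α ≤ 1) ∧
      (∀ α : ℝ, 0 < α → α < 1 → 0 < c' α) ∧
      ∀ (d : ℕ) (net : WirelessNetwork d),
        (RegularlyVarying net.powerTail 0 →
          (∀ y : ℝ, 0 < y →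
            Tendsto (fun lam : ℝ => net.coverageDensity y lam / lam) atTop (𝓝 1)) ∧
          Tendsto (fun lam : ℝ => net.areaSpectralEfficiency lam / ENNReal.ofReal lam)
            atTop (𝓝 ⊤)) ∧
        (∀ α : ℝ, 0 < α → α < 1 → RegularlyVarying net.powerTail (-α) →
          (∀ y : ℝ, 0 < y →
            Tendsto (fun lam : ℝ => net.coverageDensity y lam / lam) atTop (𝓝 (c y α))) ∧
          Tendsto (fun lam : ℝ => net.areaSpectralEfficiency lam / ENNReal.ofReal lam)
            atTop (𝓝 (ENNReal.ofReal (c' α)))) ∧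
        (ClassifiedTail net.powerTail →
          (∀ α : ℝ, 0 ≤ α → α ≤ 1 → ¬ RegularlyVarying net.powerTail (-α)) →
          (∀ y : ℝ, 0 < y →
            Tendsto (fun lam : ℝ => net.coverageDensity y lam / lam) atTop (𝓝 0)) ∧
          Tendsto (fun lam : ℝ => net.areaSpectralEfficiency lam / ENNReal.ofReal lam)
            atTop (𝓝 0)) := by
  have hlim : ∀ α : ℝ, ∃ (c : ℝ → ℝ) (c' : ℝ), 0 < α → α < 1 →
      (∀ y, 0 < y → 0 ≤ c y ∧ c y ≤ 1) ∧ 0 < c' ∧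
      ∀ (d : ℕ) (net : WirelessNetwork d), RegularlyVarying net.powerTail (-α) →
        (∀ y, 0 < y → Tendsto (fun Λ => powerCoverage net.powerLaw net.W Λ y) atTop (𝓝 (c y))) ∧
        Tendsto (fun Λ => powerRate net.powerLaw net.W Λ) atTop (𝓝 (ENNReal.ofReal c')) := by
    intro α
    by_cases h : 0 < α ∧ α < 1
    · obtain ⟨c, c', hcc⟩ := WirelessNetwork.exists_limits h.1 h.2
      exact ⟨c, c', fun _ _ => hcc⟩
    · exact ⟨0, 0, fun h0 h1 => absurd ⟨h0, h1⟩ h⟩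
  choose c c' hcc using hlim
  refine ⟨fun y α => c α y, c', fun y α hy h0 h1 => (hcc α h0 h1).1 y hy,
    fun α h0 h1 => (hcc α h0 h1).2.1, fun d net => ⟨fun hF => ?_, fun α h0 h1 hF => ?_,
    fun hC hα => ?_⟩⟩
  · rw [net.powerTail_eq, ← neg_zero] at hF
    have hX := hF.tendsto_integral_invLaplace net.powerLaw_Iio le_rfl one_pos net.W_pos zero_le_one
    rw [limitExponent_zero, div_one] at hX
    have hcov : ∀ y : ℝ, 0 < y →
        Tendsto (fun Λ => powerCoverage net.powerLaw net.W Λ y) atTop (𝓝 1) :=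
      fun y hy => tendsto_powerCoverage_one hX hy
    exact ⟨fun y hy => net.tendsto_coverageDensity (hcov y hy),
      net.tendsto_areaSpectralEfficiency (tendsto_powerRate_top hcov)⟩
  · obtain ⟨hcov, hrate⟩ := (hcc α h0 h1).2.2 d net hF
    exact ⟨fun y hy => net.tendsto_coverageDensity (hcov y hy),
      net.tendsto_areaSpectralEfficiency hrate⟩
  · rw [net.powerTail_eq] at hC hα
    have hint := hC.integrable net.powerLaw_Iio hα
    exact ⟨fun y hy => net.tendsto_coverageDensity (tendsto_powerCoverage_zero net.W_pos
        net.powerLaw_Iio net.powerLaw_Ioi hint hy),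
      net.tendsto_areaSpectralEfficiency (tendsto_powerRate_zero net.W_pos net.powerLaw_Iio
        net.powerLaw_Ioi hint)⟩
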